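/- **Setting.** Let $K\ge 1$, $\rho:\mathbb R\to\mathbb R$ be twice differentiable with bounded $\rho',\rho''$, let $\ell:\mathbb R^{d_{\rm out}}\to\mathbb R$ be differentiable with Lipschitz gradient, and fix $x\in\mathbb R^{d_{\rm in}}$, $\eta_u,\eta_v,\sigma_u,\sigma_v\in\mathbb R$. On a probability space let $W_{\rm in}\in\mathbb R^{d_{\rm in}}$, $W_{\rm out}\in\mathbb R^{d_{\rm out}}$ be subgaussian random vectors (not necessarily centered or independent; $X$ is subgaussian if for some $c$, $\mathbb E\,e^{u^\top(X-\mathbb E X)}\le e^{c\|u\|^2/2}$ for all $u$) and $\mathcal F_W=\sigma(W_{\rm in},W_{\rm out})$. For random paths $\mathbf H=(H_k)_{0\le k<K}$, $\mathbf B=(B_k)_{0\le k<K}$ in $C([0,1],\mathbb R^K)$ define the skeleton maps by $F_0=G_0=0$ and, evaluated at $(s,\mathbf z^h,\mathbf z^b)$, $$F_{k+1}=F_k-\eta_u\,\rho'\big(z^h_k+\mathbb E[H_kF_k]\big)\big(z^b_k+\mathbb E[B_kG_k]\big)H_k,\qquad G_{k+1}=G_k-\eta_v\,\rho\big(z_k^h+\mathbb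 E[H_kF_k]\big)B_k .$$ A solution of the limit system is an $\mathcal F_W$-measurable $(\mathbf H,\mathbf B)\in L^2(\Omega,C([0,1],\mathbb R^{2K}))$ such that, for some continuous centered Gaussian field $\mathbf Z=(\mathbf Z^h,\mathbf Z^b)$ independent of $\mathcal F_W$ with $\mathbb E[\mathbf Z^h(s)\mathbf Z^h(t)^\top]=\sigma_u^2\,\mathbb E[\mathbf H(s)\mathbf H(t)^\top]$, $\mathbb E[\mathbf Z^b(s)\mathbf Z^b(t)^\top]=\sigma_v^2\,\mathbb E[\mathbf B(s)\mathbf B(t)^\top]$, $\mathbb E[\mathbf Z^h(s)\mathbf Z^b(t)^\top]=0$, almost surely for all $k\in\{0,\dots,K-1\}$ (all functions of $s$; $F_k,G_k$ and their gradients evaluated at $(s,\mathbf Z^h(s),\mathbf Z^b(s))$; time derivatives understood in the integrated sense; $\mathbf H_{\wedge k}=(H_0,\dots,H_k)$): $$P_k=Z^h_k+\mathbb E[H_kF_k\mid\mathbf Z],\quad Q_k=Z^b_k+\mathbb E[B_kG_k\mid\mathbf Z],\quad y_k=\mathbb E[H_k(1)W_{\rm out}],$$ $$\partial_sH_k=\sigma_v^2\,\mathbb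 E\big[\rho'(P_k)\,\mathbb E[H_k\nabla_{\mathbf z^b}F_k\mid\mathbf Z]\big]\cdot\mathbf B_{\wedge k-1}+\mathbb E[\rho(P_k)G_k\mid\mathcal F_W],\qquad H_k(0)=W_{\rm in}\cdot x,$$ $$\begin{aligned}\partial_sB_k=&-\mathbb E[\rho'(P_k)F_kQ_k\mid\mathcal F_W]-\sigma_u^2\,\mathbb E\big[\rho'(P_k)\,\mathbb E[B_k\nabla_{\mathbf z^h}G_k\mid\mathbf Z]\big]\cdot\mathbf H_{\wedge k-1}\\&-\sigma_u^2\,\mathbb E\big[\rho''(P_k)Q_k\big(H_k+\mathbb E[H_k\nabla_{\mathbf z^h}F_k\mid\mathbf Z]\cdot\mathbf H_{\wedge k-1}\big)\,\big|\,\mathcal F_W\big],\qquad B_k(1)=W_{\rm out}\cdot\nabla\ell(y_k).\end{aligned}$$ **Proposition.** Let $(\mathbf H,\mathbf B)$ be a solution of the limit system. For every $k\in\{0,\dots,K-1\}$ there are deterministic continuous functions $\boldsymbol\Phi_k,\boldsymbol\Psi_k:[0,1]\to\mathbb R^{(k+1)\times(d_{\rm in}+d_{\rm out})}$ such that almost surely,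 for all $s\in[0,1]$, $$\mathbf H_{\wedge k}(s)=\boldsymbol\Phi_k(s)\begin{pmatrix}W_{\rm in}\\W_{\rm out}\end{pmatrix},\qquad \mathbf B_{\wedge k}(s)=\boldsymbol\Psi_k(s)\begin{pmatrix}W_{\rm in}\\W_{\rm out}\end{pmatrix}.$$ For fixed $\rho,\ell,x,\eta_u,\eta_v,\sigma_u,\sigma_v$, they depend on the probability space, the embeddings and the solution only through the covariances $\boldsymbol\Gamma^H_{\wedge k}(s)=\mathbb E[\mathbf H_{\wedge k}(s)\mathbf H_{\wedge k}(s)^\top]$ and $\boldsymbol\Gamma^B_{\wedge k}(s)=\mathbb E[\mathbf B_{\wedge k}(s)\mathbf B_{\wedge k}(s)^\top]$, $s\in[0,1]$, and through the outputs (cross-moments with $W_{\rm out}$) $y_0,\dots,y_{k-1}$ for $\boldsymbol\Phi_k$, respectively $y_0,\dots,y_k$ for $\boldsymbol\Psi_k$. Moreover: 1. If $\mathbb E W_{\rm in}=0$ and $\mathbb E W_{\rm out}=0$, then $\mathbb E\,\mathbf H(s)=\mathbb E\,\mathbf B(s)=0$ for all $s$. 2. If $(W_{\rm in},W_{\rm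 out})$ is a Gaussian vector, then $(\mathbf H,\mathbf B)$ is a Gaussian process. 3. Almost surely, $\sup_s\|(\mathbf H,\mathbf B)(s)\|_2\le\sup_{s}\big[\|\boldsymbol\Phi_{K-1}(s)\|_{op}+\|\boldsymbol\Psi_{K-1}(s)\|_{op}\big]\,\big[\|W_{\rm in}\|_2+\|W_{\rm out}\|_2\big]$; in particular, if $W_{\rm in},W_{\rm out}$ are a.s. bounded, then $(\mathbf H,\mathbf B)$ is a.s. bounded. 4. $(\mathbf H,\mathbf B)$ has moments of all orders as a random variable in $C([0,1],\mathbb R^{2K})$. -/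

import Mathlib

open MeasureTheory ProbabilityTheory
open scoped unitInterval NNReal ENNReal

noncomputable section

namespace LimitDynamics

/-- `ℝⁿ` with its Euclidean norm. -/
abbrev Euc (n : ℕ) := EuclideanSpace ℝ (Fin n)

/-- The fixed data of the training dynamics: activation, loss, input, learning rates and
standard deviations of the initial weights. -/
structure Model (din dout : ℕ) where
  /-- activation function -/
  rho : ℝ → ℝ
  /-- loss function -/
  loss : Euc dout → ℝ
  /-- training input -/
  x : Euc din
  /-- learning rate of the input weights `U` -/
  etaU : ℝ
  /-- learning rate of the output weights `V` -/
  etaV : ℝ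
  /-- standard deviation of the input weights `U` -/
  sigU : ℝ
  /-- standard deviation of the output weights `V` -/
  sigV : ℝ

/-- The activation has bounded derivatives of order one and two; the gradient of the loss is
Lipschitz. -/
structure Model.Regular {din dout : ℕ} (M : Model din dout) : Prop where
  rho_differentiable : Differentiable ℝ M.rho
  deriv_rho_differentiable : Differentiable ℝ (deriv M.rho)
  bounded : ∃ C : ℝ, ∀ t, |deriv M.rho t| ≤ C ∧ |deriv (deriv M.rho) t| ≤ C
  loss_differentiable : Differentiable ℝ M.loss
  gradient_lipschitz : ∃ C : ℝ≥0, LipschitzWith C (gradient M.loss)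

/-- A random vector is subgaussian if, for some `c`,
`𝔼 exp ⟪u, X - 𝔼 X⟫ ≤ exp (c ‖u‖² / 2)` for all `u`. -/
def IsSubgaussianVector {Ω : Type*} [MeasurableSpace Ω] {n : ℕ} (X : Ω → Euc n)
    (μ : Measure Ω) : Prop :=
  Integrable X μ ∧
    ∃ c : ℝ≥0, ∀ u : Euc n,
      HasSubgaussianMGF (fun ω => inner ℝ u (X ω - ∫ ω', X ω' ∂μ)) (c * ‖u‖₊ ^ 2) μ

/-- The sigma-field generated by the embeddings `(Win, Wout)`. -/
abbrev sigmaW {Ω : Type*} {din dout : ℕ} (Win : Ω → Euc din) (Wout : Ω → Euc dout) :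
    MeasurableSpace Ω :=
  MeasurableSpace.comap (fun ω => (Win ω, Wout ω)) inferInstance

/-- The sigma-field generated by the random path `(Zh, Zb)`. -/
abbrev sigmaZ {Ω : Type*} {K : ℕ} (Zh Zb : Ω → C(I, Euc K)) : MeasurableSpace Ω :=
  ⨆ s : I, MeasurableSpace.comap (fun ω => (Zh ω s, Zb ω s)) inferInstance

section System

variable {Ω : Type*} [MeasurableSpace Ω] {K din dout : ℕ} (M : Model din dout) (μ : Measure Ω)
  (Win : Ω → Euc din) (Wout : Ω → Euc dout) (H B Zh Zb : Ω → C(I, Euc K))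

/-- The pair `(F_k, G_k)(s, zh, zb)`, `0 ≤ k ≤ K`, of mean-field skeleton maps of `(H, B)`. -/
def skeleton (s : I) (zh zb : Euc K) : Fin (K + 1) → (Ω → ℝ) × (Ω → ℝ) :=
  Fin.induction (fun _ => 0, fun _ => 0) fun k FG =>
    let p : ℝ := zh k + ∫ ω, H ω s k * FG.1 ω ∂μ
    let q : ℝ := zb k + ∫ ω, B ω s k * FG.2 ω ∂μ
    (fun ω => FG.1 ω - M.etaU * deriv M.rho p * q * H ω s k,
      fun ω => FG.2 ω - M.etaV * M.rho p * B ω s k)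

/-- `F_k(s, zh, zb)` for `k = 0, …, K-1`. -/
def skelF (k : Fin K) (s : I) (zh zb : Euc K) (ω : Ω) : ℝ :=
  (skeleton M μ H B s zh zb k.castSucc).1 ω

/-- `G_k(s, zh, zb)` for `k = 0, …, K-1`. -/
def skelG (k : Fin K) (s : I) (zh zb : Euc K) (ω : Ω) : ℝ :=
  (skeleton M μ H B s zh zb k.castSucc).2 ω

/-- `P_k(s) = Zh_k(s) + 𝔼[H_k(s) F_k(s, Zh(s), Zb(s)) | Zh, Zb]`. -/
def preactP (k : Fin K) (s : I) (ω : Ω) : ℝ :=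
  Zh ω s k +
    (μ[fun ω' => H ω' s k * skelF M μ H B k s (Zh ω' s) (Zb ω' s) ω' | sigmaZ Zh Zb]) ω

/-- `Q_k(s) = Zb_k(s) + 𝔼[B_k(s) G_k(s, Zh(s), Zb(s)) | Zh, Zb]`. -/
def preactQ (k : Fin K) (s : I) (ω : Ω) : ℝ :=
  Zb ω s k +
    (μ[fun ω' => B ω' s k * skelG M μ H B k s (Zh ω' s) (Zb ω' s) ω' | sigmaZ Zh Zb]) ω

/-- The `j`-th coordinate of `𝔼[H_k(s) ∇_{zb} F_k(s, Zh(s), Zb(s)) | Zh, Zb]`. -/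
def respHFb (k : Fin K) (s : I) (j : Fin K) : Ω → ℝ :=
  μ[fun ω => H ω s k *
    (gradient (fun z => skelF M μ H B k s (Zh ω s) z ω) (Zb ω s)) j | sigmaZ Zh Zb]

/-- The `j`-th coordinate of `𝔼[H_k(s) ∇_{zh} F_k(s, Zh(s), Zb(s)) | Zh, Zb]`. -/
def respHFh (k : Fin K) (s : I) (j : Fin K) : Ω → ℝ :=
  μ[fun ω => H ω s k *
    (gradient (fun z => skelF M μ H B k s z (Zb ω s) ω) (Zh ω s)) j | sigmaZ Zh Zb]

/-- The `j`-th coordinate of `𝔼[B_k(s) ∇_{zh} G_k(s, Zh(s), Zb(s)) | Zh, Zb]`. -/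
def respBGh (k : Fin K) (s : I) (j : Fin K) : Ω → ℝ :=
  μ[fun ω => B ω s k *
    (gradient (fun z => skelG M μ H B k s z (Zb ω s) ω) (Zh ω s)) j | sigmaZ Zh Zb]

/-- The right-hand side of the equation for `∂ₛ H_k(s)`. -/
def driftH (k : Fin K) (s : I) (ω : Ω) : ℝ :=
  M.sigV ^ 2 * ∑ j ∈ Finset.Iio k,
      (∫ ω', deriv M.rho (preactP M μ H B Zh Zb k s ω') *
        respHFb M μ H B Zh Zb k s j ω' ∂μ) * B ω s j
    + (μ[fun ω' => M.rho (preactP M μ H B Zh Zb k s ω') *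
        skelG M μ H B k s (Zh ω' s) (Zb ω' s) ω' | sigmaW Win Wout]) ω

/-- The right-hand side of the equation for `∂ₛ B_k(s)`. -/
def driftB (k : Fin K) (s : I) (ω : Ω) : ℝ :=
  - (μ[fun ω' => deriv M.rho (preactP M μ H B Zh Zb k s ω') *
        skelF M μ H B k s (Zh ω' s) (Zb ω' s) ω' *
        preactQ M μ H B Zh Zb k s ω' | sigmaW Win Wout]) ω
    - M.sigU ^ 2 * ∑ j ∈ Finset.Iio k,
        (∫ ω', deriv M.rho (preactP M μ H B Zh Zb k s ω') *
          respBGh M μ H B Zh Zb k s j ω' ∂μ) * H ω s j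
    - M.sigU ^ 2 *
        (μ[fun ω' => deriv (deriv M.rho) (preactP M μ H B Zh Zb k s ω') *
          preactQ M μ H B Zh Zb k s ω' *
          (H ω' s k + ∑ j ∈ Finset.Iio k, respHFh M μ H B Zh Zb k s j ω' * H ω' s j)
            | sigmaW Win Wout]) ω

/-- The outputs `y_k = 𝔼[H_k(1) Wout]`. -/
def output (k : Fin K) : Euc dout :=
  ∫ ω, H ω 1 k • Wout ω ∂μ

/-- `(Zh, Zb)` is a centered Gaussian field, independent of `(Win, Wout)`, with the covariance
of `(U H, V B)`, where `U`, `V` are centered with variances `sigU²`, `sigV²` and `U`, `V`,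
`(H, B)` are independent. -/
structure IsLimitField : Prop where
  measurable_h : ∀ s, Measurable fun ω => Zh ω s
  measurable_b : ∀ s, Measurable fun ω => Zb ω s
  gaussian : IsGaussianProcess (fun (s : I) ω => (Zh ω s, Zb ω s)) μ
  centered_h : ∀ s, ∫ ω, Zh ω s ∂μ = 0
  centered_b : ∀ s, ∫ ω, Zb ω s ∂μ = 0
  cov_hh : ∀ (s t : I) (i j : Fin K),
    ∫ ω, Zh ω s i * Zh ω t j ∂μ = M.sigU ^ 2 * ∫ ω, H ω s i * H ω t j ∂μ
  cov_bb : ∀ (s t : I) (i j : Fin K),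
    ∫ ω, Zb ω s i * Zb ω t j ∂μ = M.sigV ^ 2 * ∫ ω, B ω s i * B ω t j ∂μ
  cov_hb : ∀ (s t : I) (i j : Fin K), ∫ ω, Zh ω s i * Zb ω t j ∂μ = 0
  indep : Indep (sigmaW Win Wout) (sigmaZ Zh Zb) μ

/-- `(H, B)` is a solution of the limit system driven by the field `(Zh, Zb)`: it is
`σ(Win, Wout)`-measurable, lies in `L²(Ω, C([0,1], ℝ²ᴷ))`, and almost surely
`∂ₛ H_k = driftH`, `H_k(0) = Win · x`, `∂ₛ B_k = driftB`, `B_k(1) = Wout · ∇loss(y_k)`.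
The time derivatives are understood in the integrated (absolutely continuous) sense; `DH`, `DB`
are jointly measurable versions of the right-hand sides, which involve conditional
expectations. -/
structure IsSolutionWith : Prop where
  field : IsLimitField M μ Win Wout H B Zh Zb
  memLp_H : MemLp H 2 μ
  memLp_B : MemLp B 2 μ
  adapted_H : AEStronglyMeasurable[sigmaW Win Wout] H μ
  adapted_B : AEStronglyMeasurable[sigmaW Win Wout] B μ
  eq_H : ∀ k : Fin K, ∃ DH : ℝ → Ω → ℝ, Measurable (Function.uncurry DH) ∧
    (∀ s : I, DH s =ᵐ[μ] driftH M μ Win Wout H B Zh Zb k s) ∧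
    ∀ᵐ ω ∂μ, IntervalIntegrable (fun r => DH r ω) volume 0 1 ∧
      ∀ s : I, H ω s k = inner ℝ (Win ω) M.x + ∫ r in (0 : ℝ)..s, DH r ω
  eq_B : ∀ k : Fin K, ∃ DB : ℝ → Ω → ℝ, Measurable (Function.uncurry DB) ∧
    (∀ s : I, DB s =ᵐ[μ] driftB M μ Win Wout H B Zh Zb k s) ∧
    ∀ᵐ ω ∂μ, IntervalIntegrable (fun r => DB r ω) volume 0 1 ∧
      ∀ s : I, B ω s k =
        inner ℝ (Wout ω) (gradient M.loss (output μ Wout H k)) - ∫ r in (s : ℝ)..1, DB r ω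

/-- `(H, B)` is a solution of the limit system. -/
def IsLimitSolution : Prop :=
  ∃ Zh Zb : Ω → C(I, Euc K), IsSolutionWith M μ Win Wout H B Zh Zb

end System

/-- The first `k + 1` coordinates (indices `0, …, k`) of a vector of `ℝᴷ`. -/
def upTo {K : ℕ} (k : Fin K) (v : Euc K) : Fin (k + 1) → ℝ :=
  fun i => v (Fin.castLE k.isLt i)

/-- The matrix `Γ_{∧k}(s) = 𝔼[X_{∧k}(s) X_{∧k}(s)ᵀ]` of a random path `X`. -/
def gammaUpTo {Ω : Type*} [MeasurableSpace Ω] {K : ℕ} (μ : Measure Ω) (X : Ω → C(I, Euc K))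
    (k : Fin K) (s : I) : Matrix (Fin (k + 1)) (Fin (k + 1)) ℝ :=
  Matrix.of fun i j => ∫ ω, upTo k (X ω s) i * upTo k (X ω s) j ∂μ

/-- The operator norm of a matrix for the Euclidean norms. -/
def matOpNorm {m n : Type*} [Fintype m] [Fintype n] [DecidableEq n] (A : Matrix m n ℝ) : ℝ :=
  ‖LinearMap.toContinuousLinearMap (Matrix.toEuclideanLin A)‖

end LimitDynamics

end

/-!
The field `(Zh, Zb)` is independent of the embeddings, and `(H, B)` is a function of the embeddings.
Hence the skeleton maps see `(H, B)` only through its second moments: unfolding the recursion,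
`F_k = ∑_{j < k} a_j H_j` and `G_k = ∑_{j < k} b_j B_j`, where `a_j`, `b_j` are functions of the Gram
tables of `(H(s), B(s))` and of the point `(zh, zb)` (`skelCoef`, `skeleton_eq`). Conditioning on the
field therefore turns products `H_k H_i` into entries of the Gram tables, and conditioning on the
embeddings turns functions of the field into their means. This makes both drifts deterministic
linear combinations of the coordinates (`IsSolutionWith.driftH_eq`, `IsSolutionWith.driftB_eq`):
`∂ₛ H_k` involves `B_0, …, B_{k-1}` and `∂ₛ B_k` involves `H_0, …, H_k`.

The coefficients are means over the field at a fixed time, a centered Gaussian vector whose law is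
determined by the Gram tables (`limitLaw`). The function integrated at level `k` only involves
the indices `0, …, k`, so only the corresponding block of the tables matters
(`IsSolutionWith.integral_eq_driftCoef`). The coefficients are bounded in time because all the
functions of the field have polynomial growth (`PolyGrowth`, `SmoothGrowth`), with their
derivatives, and moments of Gaussian vectors are controlled by their variances.

The system is triangular, so it can be solved one level at a time: the rows `rowH`, `rowB` solve the
same linear system with the boundary rows `x` and `∇loss(y_k)`, and `IsSolutionWith.row_spec` shows
by induction, using Fubini's theorem to exchange "for every time, almost surely" and "almost surely,
for almost every time", that `H_k(s)` and `B_k(s)` are the products of these rows with the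
embeddings. The statements on means, Gaussianity, bounds and moments are consequences of this linear
representation.
-/

noncomputable section

namespace LimitDynamics

/-! ### Functions of polynomial growth -/

/-- A table of second moments. -/
abbrev Gram (K : ℕ) := Fin K → Fin K → ℝ

/-- The arguments of the skeleton maps once `(H, B)` enters only through its second moments: the
two Gram tables `(Γᴴ, Γᴮ)`, then the point `(zh, zb)`. -/
abbrev State (K : ℕ) := (Gram K × Gram K) × (Euc K × Euc K)

/-- Measurable functions with at most polynomial growth. -/
def PolyGrowth {E : Type*} [NormedAddCommGroup E] [MeasurableSpace E] (φ : E → ℝ) : Prop :=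
  Measurable φ ∧ ∃ (C : ℝ) (n : ℕ), 0 ≤ C ∧ ∀ u, |φ u| ≤ C * (1 + ‖u‖) ^ n

namespace PolyGrowth

variable {E : Type*} [NormedAddCommGroup E] [MeasurableSpace E] {φ ψ : E → ℝ}

lemma const (c : ℝ) : PolyGrowth (fun _ : E => c) :=
  ⟨measurable_const, |c|, 0, abs_nonneg c, fun u => by simp⟩

lemma of_norm_le (h : Measurable φ) (hb : ∀ u, |φ u| ≤ ‖u‖) : PolyGrowth φ :=
  ⟨h, 1, 1, zero_le_one, fun u => by have := hb u; simp; linarith⟩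

lemma add (hφ : PolyGrowth φ) (hψ : PolyGrowth ψ) : PolyGrowth (fun u => φ u + ψ u) := by
  obtain ⟨mφ, C, n, hC, h⟩ := hφ
  obtain ⟨mψ, D, m, hD, h'⟩ := hψ
  refine ⟨mφ.add mψ, C + D, n + m, by positivity, fun u => ?_⟩
  have h1 : (1 : ℝ) ≤ 1 + ‖u‖ := by linarith [norm_nonneg u]
  calc |φ u + ψ u| ≤ |φ u| + |ψ u| := abs_add_le _ _
    _ ≤ C * (1 + ‖u‖) ^ n + D * (1 + ‖u‖) ^ m := add_le_add (h u) (h' u)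
    _ ≤ C * (1 + ‖u‖) ^ (n + m) + D * (1 + ‖u‖) ^ (n + m) := by
        gcongr <;> first | exact h1 | omega
    _ = _ := by ring

lemma mul (hφ : PolyGrowth φ) (hψ : PolyGrowth ψ) : PolyGrowth (fun u => φ u * ψ u) := by
  obtain ⟨mφ, C, n, hC, h⟩ := hφ
  obtain ⟨mψ, D, m, hD, h'⟩ := hψ
  refine ⟨mφ.mul mψ, C * D, n + m, by positivity, fun u => ?_⟩
  calc |φ u * ψ u| = |φ u| * |ψ u| := abs_mul _ _
    _ ≤ (C * (1 + ‖u‖) ^ n) * (D * (1 + ‖u‖) ^ m) :=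
        mul_le_mul (h u) (h' u) (abs_nonneg _) (by positivity)
    _ = _ := by ring

lemma const_mul (c : ℝ) (hφ : PolyGrowth φ) : PolyGrowth (fun u => c * φ u) :=
  (const c).mul hφ

lemma neg (hφ : PolyGrowth φ) : PolyGrowth (fun u => -φ u) := by
  simpa using hφ.const_mul (-1)

lemma sub (hφ : PolyGrowth φ) (hψ : PolyGrowth ψ) : PolyGrowth (fun u => φ u - ψ u) := by
  simpa [sub_eq_add_neg] using hφ.add hψ.neg

lemma sum {ι : Type*} (s : Finset ι) {f : ι → E → ℝ} (h : ∀ i ∈ s, PolyGrowth (f i)) :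
    PolyGrowth (fun u => ∑ i ∈ s, f i u) := by
  classical
  induction s using Finset.induction_on with
  | empty => simpa using const (E := E) 0
  | insert a s ha ih =>
    simp only [Finset.sum_insert ha]
    exact (h a (by simp)).add (ih fun i hi => h i (by simp [hi]))

lemma comp_real {g : ℝ → ℝ} (hφ : PolyGrowth φ) (hg : PolyGrowth g) :
    PolyGrowth (fun u => g (φ u)) := by
  obtain ⟨mφ, C, n, hC, h⟩ := hφ
  obtain ⟨mg, D, m, hD, h'⟩ := hg
  refine ⟨mg.comp mφ, D * (1 + C) ^ m, n * m, by positivity, fun u => ?_⟩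
  have h1 : (1 : ℝ) ≤ (1 + ‖u‖) ^ n := one_le_pow₀ (by linarith [norm_nonneg u])
  have h2 : 1 + ‖φ u‖ ≤ (1 + C) * (1 + ‖u‖) ^ n := by
    rw [Real.norm_eq_abs]; linarith [h u]
  calc |g (φ u)| ≤ D * (1 + ‖φ u‖) ^ m := h' _
    _ ≤ D * ((1 + C) * (1 + ‖u‖) ^ n) ^ m := by gcongr
    _ = _ := by rw [mul_pow, pow_mul]; ring

end PolyGrowth

/-- Functions of the Gram tables and of `z = (zh, zb)` which are differentiable in `z` and have
polynomial growth, together with their partial derivatives in `z`. -/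
structure SmoothGrowth {K : ℕ} (φ : State K → ℝ) : Prop where
  growth : PolyGrowth φ
  differentiable : ∀ g, Differentiable ℝ fun z => φ (g, z)
  fderiv_growth : ∀ v, PolyGrowth fun u : State K => fderiv ℝ (fun z => φ (u.1, z)) u.2 v

namespace SmoothGrowth

variable {K : ℕ} {φ ψ : State K → ℝ}

lemma of_gram {f : Gram K × Gram K → ℝ} (h : PolyGrowth fun u : State K => f u.1) :
    SmoothGrowth fun u : State K => f u.1 where
  growth := h
  differentiable g := differentiable_const (f g)
  fderiv_growth v := by simpa using PolyGrowth.const (E := State K) 0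

lemma of_clm (L : (Euc K × Euc K) →L[ℝ] ℝ) (h : PolyGrowth fun u : State K => L u.2) :
    SmoothGrowth fun u : State K => L u.2 where
  growth := h
  differentiable _ := L.differentiable
  fderiv_growth v := by
    simpa [ContinuousLinearMap.fderiv] using PolyGrowth.const (E := State K) (L v)

lemma add (hφ : SmoothGrowth φ) (hψ : SmoothGrowth ψ) : SmoothGrowth fun u => φ u + ψ u where
  growth := hφ.growth.add hψ.growth
  differentiable g := (hφ.differentiable g).add (hψ.differentiable g)
  fderiv_growth v := by
    refine (congrArg PolyGrowth (funext fun u => ?_)).mp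
      ((hφ.fderiv_growth v).add (hψ.fderiv_growth v))
    rw [fderiv_fun_add (hφ.differentiable _ _) (hψ.differentiable _ _)]
    rfl

lemma mul (hφ : SmoothGrowth φ) (hψ : SmoothGrowth ψ) : SmoothGrowth fun u => φ u * ψ u where
  growth := hφ.growth.mul hψ.growth
  differentiable g := (hφ.differentiable g).mul (hψ.differentiable g)
  fderiv_growth v := by
    refine (congrArg PolyGrowth (funext fun u => ?_)).mp
      ((hφ.growth.mul (hψ.fderiv_growth v)).add (hψ.growth.mul (hφ.fderiv_growth v)))
    rw [fderiv_fun_mul (hφ.differentiable _ _) (hψ.differentiable _ _)]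
    simp

lemma const (c : ℝ) : SmoothGrowth fun _ : State K => c :=
  of_gram (f := fun _ => c) (PolyGrowth.const c)

lemma neg (hφ : SmoothGrowth φ) : SmoothGrowth fun u => -φ u := by
  simpa using (const (-1)).mul hφ

lemma sum {ι : Type*} (s : Finset ι) {f : ι → State K → ℝ} (h : ∀ i ∈ s, SmoothGrowth (f i)) :
    SmoothGrowth (fun u => ∑ i ∈ s, f i u) := by
  classical
  induction s using Finset.induction_on with
  | empty => simpa using const 0
  | insert a s ha ih =>
    simp only [Finset.sum_insert ha]
    exact (h a (by simp)).add (ih fun i hi => h i (by simp [hi]))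

lemma comp_real {g : ℝ → ℝ} (hφ : SmoothGrowth φ) (hg : PolyGrowth g) (hd : Differentiable ℝ g)
    (hg' : PolyGrowth (deriv g)) : SmoothGrowth fun u => g (φ u) where
  growth := hφ.growth.comp_real hg
  differentiable g := hd.comp (hφ.differentiable g)
  fderiv_growth v := by
    refine (congrArg PolyGrowth (funext fun u => ?_)).mp
      ((hφ.growth.comp_real hg').mul (hφ.fderiv_growth v))
    have := ((hd (φ (u.1, u.2))).hasDerivAt.comp_hasFDerivAt u.2
      (hφ.differentiable u.1 u.2).hasFDerivAt).fderiv
    simp only [Function.comp_def] at this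
    rw [this]
    simp

end SmoothGrowth

lemma polyGrowth_gram_fst {K : ℕ} (i j : Fin K) : PolyGrowth fun u : State K => u.1.1 i j :=
  .of_norm_le (by fun_prop) fun u =>
    ((norm_le_pi_norm (u.1.1 i) j).trans (norm_le_pi_norm u.1.1 i)).trans
      ((norm_fst_le u.1).trans (norm_fst_le u))

lemma polyGrowth_gram_snd {K : ℕ} (i j : Fin K) : PolyGrowth fun u : State K => u.1.2 i j :=
  .of_norm_le (by fun_prop) fun u =>
    ((norm_le_pi_norm (u.1.2 i) j).trans (norm_le_pi_norm u.1.2 i)).trans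
      ((norm_snd_le u.1).trans (norm_fst_le u))

lemma smoothGrowth_z_fst {K : ℕ} (i : Fin K) : SmoothGrowth fun u : State K => u.2.1 i :=
  .of_clm ((EuclideanSpace.proj i).comp (ContinuousLinearMap.fst ℝ _ _)) <|
    .of_norm_le (by simp; fun_prop) fun u => (PiLp.norm_apply_le u.2.1 i).trans
      ((norm_fst_le u.2).trans (norm_snd_le u))

lemma smoothGrowth_z_snd {K : ℕ} (i : Fin K) : SmoothGrowth fun u : State K => u.2.2 i :=
  .of_clm ((EuclideanSpace.proj i).comp (ContinuousLinearMap.snd ℝ _ _)) <|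
    .of_norm_le (by simp; fun_prop) fun u => (PiLp.norm_apply_le u.2.2 i).trans
      ((norm_snd_le u.2).trans (norm_snd_le u))

/-! ### The activation and its derivatives -/

section Activation

variable {din dout : ℕ} {M : Model din dout}

lemma Model.Regular.polyGrowth_deriv2_rho (hM : M.Regular) :
    PolyGrowth (deriv (deriv M.rho)) := by
  obtain ⟨C, hC⟩ := hM.bounded
  exact ⟨measurable_deriv _, C, 0, (abs_nonneg _).trans (hC 0).1, fun t => by simpa using (hC t).2⟩

lemma Model.Regular.polyGrowth_deriv_rho (hM : M.Regular) : PolyGrowth (deriv M.rho) := by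
  obtain ⟨C, hC⟩ := hM.bounded
  exact ⟨measurable_deriv _, C, 0, (abs_nonneg _).trans (hC 0).1, fun t => by simpa using (hC t).1⟩

lemma Model.Regular.polyGrowth_rho (hM : M.Regular) : PolyGrowth M.rho := by
  obtain ⟨C, hC⟩ := hM.bounded
  have hC0 : 0 ≤ C := (abs_nonneg _).trans (hC 0).1
  refine ⟨hM.rho_differentiable.continuous.measurable, |M.rho 0| + C, 1, by positivity,
    fun t => ?_⟩
  have := Convex.norm_image_sub_le_of_norm_deriv_le (f := M.rho) (s := Set.univ) (x := 0) (y := t)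
    (C := C) (fun x _ => hM.rho_differentiable x) (fun x _ => (hC x).1) convex_univ
    (Set.mem_univ _) (Set.mem_univ _)
  simp only [Real.norm_eq_abs, sub_zero] at this
  have h2 : |M.rho t| ≤ |M.rho t - M.rho 0| + |M.rho 0| := by
    simpa using abs_add_le (M.rho t - M.rho 0) (M.rho 0)
  rw [pow_one, Real.norm_eq_abs]
  nlinarith [abs_nonneg t, abs_nonneg (M.rho 0), mul_nonneg (abs_nonneg t) (abs_nonneg (M.rho 0))]

end Activation

/-! ### The skeleton maps in terms of second moments -/

section Coefficients

variable {K din dout : ℕ} (M : Model din dout)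

/-- The coefficients `(a_k, b_k)` of `H_k` and `B_k` in the expansions `F_m = ∑_{j < m} a_j H_j` and
`G_m = ∑_{j < m} b_j B_j` of the skeleton maps. -/
def skelCoef (u : State K) (k : Fin K) : ℝ × ℝ :=
  (-(M.etaU * deriv M.rho
        (u.2.1 k + ∑ i ∈ (Finset.Iio k).attach, (skelCoef u i.1).1 * u.1.1 k i.1) *
      (u.2.2 k + ∑ i ∈ (Finset.Iio k).attach, (skelCoef u i.1).2 * u.1.2 k i.1)),
    -(M.etaV * M.rho
        (u.2.1 k + ∑ i ∈ (Finset.Iio k).attach, (skelCoef u i.1).1 * u.1.1 k i.1)))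
termination_by k
decreasing_by all_goals exact Fin.lt_def.1 (Finset.mem_Iio.1 i.2)

/-- The coefficient of `H_k` in `F_m`, `m > k`. -/
def coefF (k : Fin K) (u : State K) : ℝ := (skelCoef M u k).1

/-- The coefficient of `B_k` in `G_m`, `m > k`. -/
def coefG (k : Fin K) (u : State K) : ℝ := (skelCoef M u k).2

/-- The forward preactivation `zh_k + 𝔼[H_k F_k]` in terms of second moments. -/
def fieldP (k : Fin K) (u : State K) : ℝ :=
  u.2.1 k + ∑ i ∈ Finset.Iio k, coefF M i u * u.1.1 k i

/-- The backward preactivation `zb_k + 𝔼[B_k G_k]` in terms of second moments. -/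
def fieldQ (k : Fin K) (u : State K) : ℝ :=
  u.2.2 k + ∑ i ∈ Finset.Iio k, coefG M i u * u.1.2 k i

lemma coefF_eq (k : Fin K) (u : State K) :
    coefF M k u = -(M.etaU * deriv M.rho (fieldP M k u) * fieldQ M k u) := by
  rw [coefF, skelCoef, fieldP, fieldQ]
  simp only [coefF, coefG]
  rw [Finset.sum_attach (Finset.Iio k) (fun i => (skelCoef M u i).1 * u.1.1 k i),
    Finset.sum_attach (Finset.Iio k) (fun i => (skelCoef M u i).2 * u.1.2 k i)]

lemma coefG_eq (k : Fin K) (u : State K) :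
    coefG M k u = -(M.etaV * M.rho (fieldP M k u)) := by
  rw [coefG, skelCoef, fieldP]
  simp only [coefF]
  rw [Finset.sum_attach (Finset.Iio k) (fun i => (skelCoef M u i).1 * u.1.1 k i)]

variable {M}

lemma smoothGrowth_fieldP_of {k : Fin K} (h : ∀ i < k, SmoothGrowth (coefF M i)) :
    SmoothGrowth (fieldP M k) :=
  (smoothGrowth_z_fst k).add <| .sum _ fun i hi => (h i (Finset.mem_Iio.1 hi)).mul
    (.of_gram (f := fun g => g.1 k i) (polyGrowth_gram_fst k i))

lemma smoothGrowth_fieldQ_of {k : Fin K} (h : ∀ i < k, SmoothGrowth (coefG M i)) :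
    SmoothGrowth (fieldQ M k) :=
  (smoothGrowth_z_snd k).add <| .sum _ fun i hi => (h i (Finset.mem_Iio.1 hi)).mul
    (.of_gram (f := fun g => g.2 k i) (polyGrowth_gram_snd k i))

lemma smoothGrowth_coef (hM : M.Regular) (k : Fin K) :
    SmoothGrowth (coefF M k) ∧ SmoothGrowth (coefG M k) := by
  induction k using WellFoundedLT.induction with
  | ind k ih =>
    have hP := smoothGrowth_fieldP_of fun i hi => (ih i hi).1
    have hQ := smoothGrowth_fieldQ_of fun i hi => (ih i hi).2
    constructor
    · rw [funext (coefF_eq M k)]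
      exact (((SmoothGrowth.const _).mul (hP.comp_real hM.polyGrowth_deriv_rho
        hM.deriv_rho_differentiable hM.polyGrowth_deriv2_rho)).mul hQ).neg
    · rw [funext (coefG_eq M k)]
      exact ((SmoothGrowth.const _).mul (hP.comp_real hM.polyGrowth_rho
        hM.rho_differentiable hM.polyGrowth_deriv_rho)).neg

lemma smoothGrowth_coefF (hM : M.Regular) (k : Fin K) : SmoothGrowth (coefF M k) :=
  (smoothGrowth_coef hM k).1

lemma smoothGrowth_coefG (hM : M.Regular) (k : Fin K) : SmoothGrowth (coefG M k) :=
  (smoothGrowth_coef hM k).2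

lemma smoothGrowth_fieldP (hM : M.Regular) (k : Fin K) : SmoothGrowth (fieldP M k) :=
  smoothGrowth_fieldP_of fun i _ => smoothGrowth_coefF hM i

lemma smoothGrowth_fieldQ (hM : M.Regular) (k : Fin K) : SmoothGrowth (fieldQ M k) :=
  smoothGrowth_fieldQ_of fun i _ => smoothGrowth_coefG hM i

variable (M)

/-- The derivative of the coefficient of `H_i` in direction `zh_j`. -/
def dhCoefF (i j : Fin K) (u : State K) : ℝ :=
  fderiv ℝ (fun z => coefF M i (u.1, z)) u.2 (EuclideanSpace.single j 1, 0)

/-- The derivative of the coefficient of `H_i` in direction `zb_j`. -/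
def dbCoefF (i j : Fin K) (u : State K) : ℝ :=
  fderiv ℝ (fun z => coefF M i (u.1, z)) u.2 (0, EuclideanSpace.single j 1)

/-- The derivative of the coefficient of `B_i` in direction `zh_j`. -/
def dhCoefG (i j : Fin K) (u : State K) : ℝ :=
  fderiv ℝ (fun z => coefG M i (u.1, z)) u.2 (EuclideanSpace.single j 1, 0)

/-- The function of the field whose mean is the coefficient of `B_j`, `j < k`, in `∂ₛ H_k`. -/
def kernelH (k j : Fin K) (u : State K) : ℝ :=
  M.sigV ^ 2 * (deriv M.rho (fieldP M k u) *
      ∑ i ∈ Finset.Iio k, dbCoefF M i j u * u.1.1 k i)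
    + M.rho (fieldP M k u) * coefG M j u

/-- The function of the field whose mean is the coefficient of `H_j`, `j < k`, in `∂ₛ B_k`. -/
def kernelB (k j : Fin K) (u : State K) : ℝ :=
  -(deriv M.rho (fieldP M k u) * coefF M j u * fieldQ M k u)
    - M.sigU ^ 2 * (deriv M.rho (fieldP M k u) *
      ∑ i ∈ Finset.Iio k, dhCoefG M i j u * u.1.2 k i)
    - M.sigU ^ 2 * (deriv (deriv M.rho) (fieldP M k u) * fieldQ M k u *
      ∑ i ∈ Finset.Iio k, dhCoefF M i j u * u.1.1 k i)

/-- The function of the field whose mean is the coefficient of `H_k` in `∂ₛ B_k`. -/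
def kernelBDiag (k : Fin K) (u : State K) : ℝ :=
  -(M.sigU ^ 2 * (deriv (deriv M.rho) (fieldP M k u) * fieldQ M k u))

variable {M}

lemma polyGrowth_dhCoefF (hM : M.Regular) (i j : Fin K) : PolyGrowth (dhCoefF M i j) :=
  (smoothGrowth_coefF hM i).fderiv_growth _

lemma polyGrowth_dbCoefF (hM : M.Regular) (i j : Fin K) : PolyGrowth (dbCoefF M i j) :=
  (smoothGrowth_coefF hM i).fderiv_growth _

lemma polyGrowth_dhCoefG (hM : M.Regular) (i j : Fin K) : PolyGrowth (dhCoefG M i j) :=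
  (smoothGrowth_coefG hM i).fderiv_growth _

lemma polyGrowth_deriv_fieldP (hM : M.Regular) (k : Fin K) :
    PolyGrowth fun u => deriv M.rho (fieldP M k u) :=
  (smoothGrowth_fieldP hM k).growth.comp_real hM.polyGrowth_deriv_rho

lemma polyGrowth_deriv2_fieldP_mul (hM : M.Regular) (k : Fin K) :
    PolyGrowth fun u => deriv (deriv M.rho) (fieldP M k u) * fieldQ M k u :=
  ((smoothGrowth_fieldP hM k).growth.comp_real hM.polyGrowth_deriv2_rho).mul
    (smoothGrowth_fieldQ hM k).growth

lemma polyGrowth_respHFb (hM : M.Regular) (k j : Fin K) :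
    PolyGrowth fun u => ∑ i ∈ Finset.Iio k, dbCoefF M i j u * u.1.1 k i :=
  .sum _ fun i _ => (polyGrowth_dbCoefF hM i j).mul (polyGrowth_gram_fst k i)

lemma polyGrowth_respHFh (hM : M.Regular) (k j : Fin K) :
    PolyGrowth fun u => ∑ i ∈ Finset.Iio k, dhCoefF M i j u * u.1.1 k i :=
  .sum _ fun i _ => (polyGrowth_dhCoefF hM i j).mul (polyGrowth_gram_fst k i)

lemma polyGrowth_respBGh (hM : M.Regular) (k j : Fin K) :
    PolyGrowth fun u => ∑ i ∈ Finset.Iio k, dhCoefG M i j u * u.1.2 k i :=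
  .sum _ fun i _ => (polyGrowth_dhCoefG hM i j).mul (polyGrowth_gram_snd k i)

lemma polyGrowth_rho_mul_coefG (hM : M.Regular) (k j : Fin K) :
    PolyGrowth fun u => M.rho (fieldP M k u) * coefG M j u :=
  ((smoothGrowth_fieldP hM k).growth.comp_real hM.polyGrowth_rho).mul
    (smoothGrowth_coefG hM j).growth

lemma polyGrowth_kernelH (hM : M.Regular) (k j : Fin K) : PolyGrowth (kernelH M k j) :=
  (((polyGrowth_deriv_fieldP hM k).mul (polyGrowth_respHFb hM k j)).const_mul _).add
    (polyGrowth_rho_mul_coefG hM k j)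

lemma polyGrowth_kernelB (hM : M.Regular) (k j : Fin K) : PolyGrowth (kernelB M k j) :=
  ((((polyGrowth_deriv_fieldP hM k).mul (smoothGrowth_coefF hM j).growth).mul
      (smoothGrowth_fieldQ hM k).growth).neg.sub
    (((polyGrowth_deriv_fieldP hM k).mul (polyGrowth_respBGh hM k j)).const_mul _)).sub
    (((polyGrowth_deriv2_fieldP_mul hM k).mul (polyGrowth_respHFh hM k j)).const_mul _)

lemma polyGrowth_kernelBDiag (hM : M.Regular) (k : Fin K) : PolyGrowth (kernelBDiag M k) :=
  ((polyGrowth_deriv2_fieldP_mul hM k).const_mul _).neg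

end Coefficients

/-! ### Restriction to the first coordinates -/

section Truncation

variable {K din dout : ℕ} (M : Model din dout)

/-- The Gram table with all entries outside the block `0, …, k` replaced by zero. -/
def truncGram (k : Fin K) (g : Gram K) : Gram K := fun i j => if i ≤ k ∧ j ≤ k then g i j else 0

/-- The projection of `ℝᴷ` onto the coordinates `0, …, k`. -/
def truncVec (k : Fin K) : Euc K →L[ℝ] Euc K :=
  LinearMap.toContinuousLinearMap
    { toFun := fun z => WithLp.toLp 2 fun i => if i ≤ k then z i else 0
      map_add' := fun x y => by ext i; simp; split_ifs <;> simp
      map_smul' := fun c x => by ext i; simp }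

@[simp] lemma truncVec_apply (k : Fin K) (z : Euc K) (i : Fin K) :
    truncVec k z i = if i ≤ k then z i else 0 := rfl

lemma truncVec_single {k j : Fin K} (h : j ≤ k) :
    truncVec k (EuclideanSpace.single j 1) = EuclideanSpace.single j 1 := by
  ext i
  by_cases hi : i = j
  · subst hi; simp [h]
  · simp [hi]

/-- `truncVec` on both components. -/
def truncPair (k : Fin K) : (Euc K × Euc K) →L[ℝ] (Euc K × Euc K) :=
  (truncVec k).prodMap (truncVec k)

/-- Restriction of all the arguments of the skeleton maps to the indices `0, …, k`. -/
def truncState (k : Fin K) (u : State K) : State K :=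
  ((truncGram k u.1.1, truncGram k u.1.2), truncPair k u.2)

/-- The skeleton maps up to level `k` only involve the indices `0, …, k`. -/
lemma coef_truncState {k j : Fin K} (hj : j ≤ k) (u : State K) :
    coefF M j (truncState k u) = coefF M j u ∧ coefG M j (truncState k u) = coefG M j u ∧
    fieldP M j (truncState k u) = fieldP M j u ∧ fieldQ M j (truncState k u) = fieldQ M j u := by
  induction j using WellFoundedLT.induction with
  | ind j ih =>
    have hP : fieldP M j (truncState k u) = fieldP M j u := by
      simp only [fieldP]
      congr 1
      · simp [truncState, truncPair, hj]
      · refine Finset.sum_congr rfl fun i hi => ?_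
        have hij := Finset.mem_Iio.1 hi
        rw [(ih i hij (hij.le.trans hj)).1]
        simp [truncState, truncGram, hj, hij.le.trans hj]
    have hQ : fieldQ M j (truncState k u) = fieldQ M j u := by
      simp only [fieldQ]
      congr 1
      · simp [truncState, truncPair, hj]
      · refine Finset.sum_congr rfl fun i hi => ?_
        have hij := Finset.mem_Iio.1 hi
        rw [(ih i hij (hij.le.trans hj)).2.1]
        simp [truncState, truncGram, hj, hij.le.trans hj]
    exact ⟨by rw [coefF_eq, coefF_eq, hP, hQ], by rw [coefG_eq, coefG_eq, hP], hP, hQ⟩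

/-- Chain rule: differentiating along a direction fixed by the restriction commutes with it. -/
lemma fderiv_truncState {φ : State K → ℝ} (hφ : SmoothGrowth φ) {k : Fin K}
    (h : ∀ u, φ (truncState k u) = φ u) {v : Euc K × Euc K} (hv : truncPair k v = v)
    (u : State K) :
    fderiv ℝ (fun z => φ ((truncState k u).1, z)) (truncState k u).2 v =
      fderiv ℝ (fun z => φ (u.1, z)) u.2 v := by
  have h1 : (fun z => φ (u.1, z)) = (fun z => φ ((truncState k u).1, z)) ∘ truncPair k :=
    funext fun z => (h (u.1, z)).symm
  rw [h1, fderiv_comp _ (hφ.differentiable _ _) (truncPair k).differentiableAt,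
    ContinuousLinearMap.fderiv, ContinuousLinearMap.comp_apply, hv]
  rfl

variable {M}

lemma dCoef_truncState (hM : M.Regular) {k i j : Fin K} (hi : i ≤ k) (hj : j ≤ k) (u : State K) :
    dhCoefF M i j (truncState k u) = dhCoefF M i j u ∧
    dbCoefF M i j (truncState k u) = dbCoefF M i j u ∧
    dhCoefG M i j (truncState k u) = dhCoefG M i j u := by
  refine ⟨fderiv_truncState (smoothGrowth_coefF hM i) (fun u => (coef_truncState M hi u).1) ?_ u,
    fderiv_truncState (smoothGrowth_coefF hM i) (fun u => (coef_truncState M hi u).1) ?_ u,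
    fderiv_truncState (smoothGrowth_coefG hM i) (fun u => (coef_truncState M hi u).2.1) ?_ u⟩ <;>
  simp [truncPair, truncVec_single hj]

lemma truncGram_apply {k i j : Fin K} (hi : i ≤ k) (hj : j ≤ k) (g : Gram K) :
    truncGram k g i j = g i j := by simp [truncGram, hi, hj]

lemma kernel_truncState (hM : M.Regular) {k j : Fin K} (hj : j ≤ k) (u : State K) :
    kernelH M k j (truncState k u) = kernelH M k j u ∧
    kernelB M k j (truncState k u) = kernelB M k j u ∧
    kernelBDiag M k (truncState k u) = kernelBDiag M k u := by
  obtain ⟨-, -, hP, hQ⟩ := coef_truncState M le_rfl (k := k) u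
  obtain ⟨hF, hG, -, -⟩ := coef_truncState M hj u
  have h1 : ∀ i ∈ Finset.Iio k, (truncState k u).1.1 k i = u.1.1 k i := fun i hi =>
    truncGram_apply le_rfl (Finset.mem_Iio.1 hi).le _
  have h2 : ∀ i ∈ Finset.Iio k, (truncState k u).1.2 k i = u.1.2 k i := fun i hi =>
    truncGram_apply le_rfl (Finset.mem_Iio.1 hi).le _
  have h3 : ∀ i ∈ Finset.Iio k, _ := fun i hi =>
    dCoef_truncState hM (Finset.mem_Iio.1 hi).le hj u
  have e1 : ∑ i ∈ Finset.Iio k, dbCoefF M i j (truncState k u) * (truncState k u).1.1 k i =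
      ∑ i ∈ Finset.Iio k, dbCoefF M i j u * u.1.1 k i :=
    Finset.sum_congr rfl fun i hi => by rw [h1 i hi, (h3 i hi).2.1]
  have e2 : ∑ i ∈ Finset.Iio k, dhCoefF M i j (truncState k u) * (truncState k u).1.1 k i =
      ∑ i ∈ Finset.Iio k, dhCoefF M i j u * u.1.1 k i :=
    Finset.sum_congr rfl fun i hi => by rw [h1 i hi, (h3 i hi).1]
  have e3 : ∑ i ∈ Finset.Iio k, dhCoefG M i j (truncState k u) * (truncState k u).1.2 k i =
      ∑ i ∈ Finset.Iio k, dhCoefG M i j u * u.1.2 k i :=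
    Finset.sum_congr rfl fun i hi => by rw [h2 i hi, (h3 i hi).2.2]
  refine ⟨?_, ?_, ?_⟩
  · simp only [kernelH, hP, hG, e1]
  · simp only [kernelB, hP, hQ, hF, e2, e3]
  · simp only [kernelBDiag, hP, hQ]

end Truncation

/-! ### Centered Gaussian vectors -/

section Gaussian

variable {Ω : Type*} [MeasurableSpace Ω] {μ : Measure Ω} {K : ℕ}

lemma integral_coord {X : Ω → Euc K} (hX : Integrable X μ) (i : Fin K) :
    (∫ ω, X ω ∂μ) i = ∫ ω, X ω i ∂μ :=
  ((EuclideanSpace.proj i : Euc K →L[ℝ] ℝ).integral_comp_comm hX).symm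

lemma hasGaussianLaw_coord {X : Ω → Euc K} (hX : HasGaussianLaw X μ) (i : Fin K) :
    HasGaussianLaw (fun ω => X ω i) μ :=
  hX.map_fun (EuclideanSpace.proj i)

/-- A centered Gaussian vector of `ℝᴷ` has the law determined by its second moments. -/
lemma map_eq_multivariateGaussian {X : Ω → Euc K} (hX : HasGaussianLaw X μ)
    (h0 : ∀ i, ∫ ω, X ω i ∂μ = 0) {S : Matrix (Fin K) (Fin K) ℝ}
    (hS : ∀ i j, ∫ ω, X ω i * X ω j ∂μ = S i j) :
    μ.map X = multivariateGaussian 0 S := by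
  have := hX.isProbabilityMeasure
  have := hX.isGaussian_map
  have hm : ∀ i, MemLp (fun ω => X ω i) 2 μ := fun i => (hasGaussianLaw_coord hX i).memLp_two
  have hcov : ∀ i j, cov[fun ω => X ω i, fun ω => X ω j; μ] = S i j := fun i j => by
    rw [covariance_eq_sub (hm i) (hm j), h0 i, zero_mul, sub_zero]
    exact hS i j
  have hbil : ∀ x y : Euc K, covarianceBilin (μ.map X) x y = x ⬝ᵥ S.mulVec y := fun x y => by
    have := covarianceBilin_apply_pi hm x y
    rw [show (fun ω => WithLp.toLp 2 (fun i => X ω i)) = X from rfl] at this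
    rw [this]
    simp only [hcov, dotProduct, Matrix.mulVec, Finset.mul_sum]
    exact Finset.sum_congr rfl fun i _ => Finset.sum_congr rfl fun j _ => by ring
  have hpsd : S.PosSemidef := by
    refine Matrix.PosSemidef.of_dotProduct_mulVec_nonneg ?_ fun x => ?_
    · ext i j
      simp [← hS, mul_comm]
    · have := hbil (WithLp.toLp 2 x) (WithLp.toLp 2 x)
      simp only [star_trivial]
      simp only at this
      rw [← this]
      exact covarianceBilin_self_nonneg _
  refine IsGaussian.ext ?_ ?_
  · simp only [id, integral_id_multivariateGaussian]
    rw [integral_map hX.aemeasurable (by fun_prop)]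
    ext i
    rw [integral_coord hX.integrable, h0 i]
    rfl
  · ext x y
    rw [hbil, covarianceBilin_multivariateGaussian hpsd]

/-- Moments of a centered real Gaussian variable are controlled by its variance. -/
lemma integral_abs_pow_le_of_gaussian {X : Ω → ℝ} (hX : HasGaussianLaw X μ)
    (h0 : ∫ ω, X ω ∂μ = 0) {V : ℝ} (hV : ∫ ω, X ω * X ω ∂μ ≤ V) (n : ℕ) :
    ∫ ω, |X ω| ^ n ∂μ ≤ √V ^ n * ∫ x, |x| ^ n ∂(gaussianReal 0 1) := by
  have hvar : Var[X; μ] ≤ V := by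
    rw [variance_of_integral_eq_zero hX.aemeasurable h0]
    simpa [pow_two] using hV
  set v := Var[X; μ].toNNReal with hv
  have hmap : μ.map X = (gaussianReal 0 1).map (√v * ·) := by
    rw [hX.map_eq_gaussianReal, h0, gaussianReal_map_const_mul, mul_zero]
    congr 1
    ext
    simp [hv]
  have h1 : ∫ ω, |X ω| ^ n ∂μ = ∫ x, |x| ^ n ∂(μ.map X) :=
    (integral_map hX.aemeasurable (f := fun x : ℝ => |x| ^ n) (by fun_prop)).symm
  have hvV : √v ≤ √V := by
    apply Real.sqrt_le_sqrt
    rw [hv, Real.coe_toNNReal _ (variance_nonneg _ _)]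
    exact hvar
  rw [h1, hmap, integral_map (by fun_prop) (by fun_prop)]
  simp only [abs_mul, mul_pow, integral_const_mul, abs_of_nonneg (Real.sqrt_nonneg _)]
  gcongr

lemma integrable_abs_pow_of_gaussian {X : Ω → ℝ} (hX : HasGaussianLaw X μ) (n : ℕ) :
    Integrable (fun ω => |X ω| ^ n) μ := by
  have := hX.isProbabilityMeasure
  simpa using (hX.memLp (p := n) (by simp)).integrable_norm_pow'

lemma norm_le_sum_abs (z : Euc K) : ‖z‖ ≤ ∑ i, |z i| := by
  have : z = ∑ i, z i • EuclideanSpace.single i (1 : ℝ) := by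
    ext j; simp [Finset.sum_apply, Pi.single_apply]
  calc ‖z‖ = ‖∑ i, z i • EuclideanSpace.single i (1 : ℝ)‖ := by rw [← this]
    _ ≤ ∑ i, ‖z i • EuclideanSpace.single i (1 : ℝ)‖ := norm_sum_le _ _
    _ = _ := by simp [norm_smul]

lemma norm_pow_le_sum (z : Euc K) (n : ℕ) :
    ‖z‖ ^ (n + 1) ≤ (K : ℝ) ^ n * ∑ i, |z i| ^ (n + 1) := by
  rcases Nat.eq_zero_or_pos K with rfl | hK
  · simp [Subsingleton.elim z 0]
  have h2 := pow_sum_div_card_le_sum_pow (s := Finset.univ) (f := fun i => |z i|)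
    (fun i _ => abs_nonneg _) n
  rw [div_le_iff₀' (by simp; positivity), Finset.card_univ, Fintype.card_fin] at h2
  exact (pow_le_pow_left₀ (norm_nonneg _) (norm_le_sum_abs z) _).trans h2

/-- A function of polynomial growth of a Gram table and of a pair of centered Gaussian vectors is
integrable, with a bound depending only on the size of the table and of the variances. -/
lemma PolyGrowth.exists_integral_bound {φ : State K → ℝ} (hφ : PolyGrowth φ) (R V : ℝ) :
    ∃ D : ℝ, ∀ (g : Gram K × Gram K) (Zh Zb : Ω → Euc K), ‖g‖ ≤ R →
      HasGaussianLaw (fun ω => (Zh ω, Zb ω)) μ →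
      (∀ i, ∫ ω, Zh ω i ∂μ = 0) → (∀ i, ∫ ω, Zb ω i ∂μ = 0) →
      (∀ i, ∫ ω, Zh ω i * Zh ω i ∂μ ≤ V) → (∀ i, ∫ ω, Zb ω i * Zb ω i ∂μ ≤ V) →
      Integrable (fun ω => φ (g, (Zh ω, Zb ω))) μ ∧
        ∫ ω, |φ (g, (Zh ω, Zb ω))| ∂μ ≤ D := by
  obtain ⟨mφ, C, n, hC, hb⟩ := hφ
  -- The exponent is raised to `n + 1`, for which powers of sums are bounded by sums of powers
  -- with a factor `card ^ n`.
  set m := ∫ x, |x| ^ (n + 1) ∂(gaussianReal 0 1) with hm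
  refine ⟨C * (2 ^ n * ((1 + R) ^ (n + 1) +
    2 ^ n * ((K : ℝ) ^ n * ∑ i : Fin K, √V ^ (n + 1) * m +
      (K : ℝ) ^ n * ∑ i : Fin K, √V ^ (n + 1) * m))), fun g Zh Zb hg hZ h0 h0' hv hv' => ?_⟩
  have := hZ.isProbabilityMeasure
  set bd : Ω → ℝ := fun ω => C * (2 ^ n * ((1 + R) ^ (n + 1) +
    2 ^ n * ((K : ℝ) ^ n * ∑ i : Fin K, |Zh ω i| ^ (n + 1) +
      (K : ℝ) ^ n * ∑ i : Fin K, |Zb ω i| ^ (n + 1)))) with hbd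
  have hle : ∀ ω, |φ (g, (Zh ω, Zb ω))| ≤ bd ω := fun ω => by
    have hR : 0 ≤ R := (norm_nonneg _).trans hg
    have e1 : ‖(g, (Zh ω, Zb ω))‖ ≤ R + (‖Zh ω‖ + ‖Zb ω‖) := by
      rw [Prod.norm_mk, Prod.norm_mk (Zh ω)]
      refine max_le (by linarith [norm_nonneg (Zh ω), norm_nonneg (Zb ω)]) (max_le ?_ ?_) <;>
        linarith [norm_nonneg (Zh ω), norm_nonneg (Zb ω)]
    have e2 : (1 + R + (‖Zh ω‖ + ‖Zb ω‖)) ^ (n + 1) ≤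
        2 ^ n * ((1 + R) ^ (n + 1) + (‖Zh ω‖ + ‖Zb ω‖) ^ (n + 1)) :=
      add_pow_le (by positivity) (by positivity) _
    have e3 : (‖Zh ω‖ + ‖Zb ω‖) ^ (n + 1) ≤
        2 ^ n * (‖Zh ω‖ ^ (n + 1) + ‖Zb ω‖ ^ (n + 1)) :=
      add_pow_le (by positivity) (by positivity) _
    calc |φ (g, (Zh ω, Zb ω))| ≤ C * (1 + ‖(g, (Zh ω, Zb ω))‖) ^ n := hb _
      _ ≤ C * (1 + ‖(g, (Zh ω, Zb ω))‖) ^ (n + 1) := by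
          gcongr
          · linarith [norm_nonneg (g, (Zh ω, Zb ω))]
          · omega
      _ ≤ C * (1 + R + (‖Zh ω‖ + ‖Zb ω‖)) ^ (n + 1) :=
          mul_le_mul_of_nonneg_left (pow_le_pow_left₀ (by positivity) (by linarith) _) hC
      _ ≤ C * (2 ^ n * ((1 + R) ^ (n + 1) +
            2 ^ n * (‖Zh ω‖ ^ (n + 1) + ‖Zb ω‖ ^ (n + 1)))) := by
          gcongr
          exact e2.trans (by gcongr)
      _ ≤ bd ω := by
          rw [hbd]
          dsimp only
          gcongr <;> exact norm_pow_le_sum _ _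
  have i1 : ∀ i, Integrable (fun ω => |Zh ω i| ^ (n + 1)) μ := fun i =>
    integrable_abs_pow_of_gaussian (hasGaussianLaw_coord hZ.fst i) _
  have i2 : ∀ i, Integrable (fun ω => |Zb ω i| ^ (n + 1)) μ := fun i =>
    integrable_abs_pow_of_gaussian (hasGaussianLaw_coord hZ.snd i) _
  have s1 := (integrable_finsetSum Finset.univ fun i _ => i1 i).const_mul ((K : ℝ) ^ n)
  have s2 := (integrable_finsetSum Finset.univ fun i _ => i2 i).const_mul ((K : ℝ) ^ n)
  have s3 : Integrable (fun ω => 2 ^ n * ((K : ℝ) ^ n * ∑ i : Fin K, |Zh ω i| ^ (n + 1) +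
      (K : ℝ) ^ n * ∑ i : Fin K, |Zb ω i| ^ (n + 1))) μ := (s1.add s2).const_mul (2 ^ n)
  have hbi : Integrable bd μ :=
    (((integrable_const ((1 + R) ^ (n + 1))).add s3).const_mul (2 ^ n)).const_mul C
  have hmeas : AEStronglyMeasurable (fun ω => φ (g, (Zh ω, Zb ω))) μ :=
    (mφ.comp_aemeasurable (aemeasurable_const.prodMk hZ.aemeasurable)).aestronglyMeasurable
  have hint : Integrable (fun ω => φ (g, (Zh ω, Zb ω))) μ :=
    hbi.mono' hmeas (Filter.Eventually.of_forall hle)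
  refine ⟨hint, (integral_mono hint.abs hbi hle).trans ?_⟩
  have hbint : ∫ ω, bd ω ∂μ = C * (2 ^ n * ((1 + R) ^ (n + 1) +
      2 ^ n * ((K : ℝ) ^ n * ∑ i : Fin K, ∫ ω, |Zh ω i| ^ (n + 1) ∂μ +
      (K : ℝ) ^ n * ∑ i : Fin K, ∫ ω, |Zb ω i| ^ (n + 1) ∂μ))) := by
    rw [hbd, integral_const_mul, integral_const_mul, integral_add (integrable_const _) s3,
      integral_const_mul, integral_add s1 s2, integral_const_mul, integral_const_mul,
      integral_finsetSum _ fun i _ => i1 i, integral_finsetSum _ fun i _ => i2 i]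
    simp
  rw [hbint]
  gcongr with i _ i _
  · exact integral_abs_pow_le_of_gaussian (hasGaussianLaw_coord hZ.fst i) (h0 i) (hv i) _
  · exact integral_abs_pow_le_of_gaussian (hasGaussianLaw_coord hZ.snd i) (h0' i) (hv' i) _

end Gaussian

/-! ### The law of the limit field at a fixed time -/

section Law

variable {K din dout : ℕ} (M : Model din dout)

/-- The law of `(Zh(s), Zb(s))` when the second moments of `(H(s), B(s))` are `g`: independent
centered Gaussian vectors with covariances `σ_u² Γᴴ` and `σ_v² Γᴮ`. -/
def limitLaw (g : Gram K × Gram K) : Measure (Euc K × Euc K) :=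
  (multivariateGaussian 0 (Matrix.of fun i j => M.sigU ^ 2 * g.1 i j)).prod
    (multivariateGaussian 0 (Matrix.of fun i j => M.sigV ^ 2 * g.2 i j))

variable {M} {Ω : Type*} [MeasurableSpace Ω] {μ : Measure Ω}

lemma map_eq_limitLaw {Zh Zb : Ω → Euc K} (hZ : HasGaussianLaw (fun ω => (Zh ω, Zb ω)) μ)
    (h0 : ∀ i, ∫ ω, Zh ω i ∂μ = 0) (h0' : ∀ i, ∫ ω, Zb ω i ∂μ = 0) {g : Gram K × Gram K}
    (hh : ∀ i j, ∫ ω, Zh ω i * Zh ω j ∂μ = M.sigU ^ 2 * g.1 i j)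
    (hb : ∀ i j, ∫ ω, Zb ω i * Zb ω j ∂μ = M.sigV ^ 2 * g.2 i j)
    (hhb : ∀ i j, ∫ ω, Zh ω i * Zb ω j ∂μ = 0) :
    μ.map (fun ω => (Zh ω, Zb ω)) = limitLaw M g := by
  have := hZ.isProbabilityMeasure
  have hind : IndepFun Zh Zb μ := by
    have hZ' : HasGaussianLaw (fun ω => (fun i => Zh ω i, fun j => Zb ω j)) μ :=
      hZ.map_fun ((PiLp.continuousLinearEquiv 2 ℝ (fun _ : Fin K => ℝ)).toContinuousLinearMap.prodMap
        (PiLp.continuousLinearEquiv 2 ℝ (fun _ : Fin K => ℝ)).toContinuousLinearMap)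
    have h := HasGaussianLaw.indepFun_of_covariance_eval (X := fun i ω => Zh ω i)
      (Y := fun i ω => Zb ω i) hZ' fun i j => by
        rw [covariance_eq_sub (hasGaussianLaw_coord hZ.fst i).memLp_two
          (hasGaussianLaw_coord hZ.snd j).memLp_two, h0 i, zero_mul, sub_zero]
        exact hhb i j
    exact h.comp (φ := WithLp.toLp 2) (ψ := WithLp.toLp 2) (by fun_prop) (by fun_prop)
  rw [(indepFun_iff_map_prod_eq_prod_map_map hZ.fst.aemeasurable hZ.snd.aemeasurable).1 hind,
    limitLaw, map_eq_multivariateGaussian hZ.fst h0 fun i j => by rw [hh]; rfl,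
    map_eq_multivariateGaussian hZ.snd h0' fun i j => by rw [hb]; rfl]
  rfl

end Law

/-! ### Conditional expectations of products of independent factors -/

section CondExp

variable {Ω : Type*} {m₁ m₂ m : MeasurableSpace Ω} {μ : Measure Ω} [IsProbabilityMeasure μ]

omit [IsProbabilityMeasure μ] in
lemma integrable_mul_of_indep (hind : Indep m₁ m₂ μ) {f X : Ω → ℝ} (hf : AEStronglyMeasurable[m₁] f μ)
    (hX : AEStronglyMeasurable[m₂] X μ) (hfi : Integrable f μ) (hXi : Integrable X μ) :
    Integrable (fun ω => f ω * X ω) μ := by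
  have hi : IndepFun (hf.mk f) (hX.mk X) μ := by
    rw [IndepFun_iff_Indep]
    exact indep_of_indep_of_le_left (indep_of_indep_of_le_right hind
      (hX.stronglyMeasurable_mk.measurable.comap_le)) hf.stronglyMeasurable_mk.measurable.comap_le
  have := hi.integrable_mul (hfi.congr hf.ae_eq_mk) (hXi.congr hX.ae_eq_mk)
  exact this.congr (hf.ae_eq_mk.mul hX.ae_eq_mk).symm

/-- Given `m₁`, factors measurable with respect to `m₁` are pulled out and factors measurable with
respect to the independent sigma-field `m₂` are replaced by their means. -/
lemma condExp_sum_mul_of_indep (h₁ : m₁ ≤ m) (h₂ : m₂ ≤ m)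
    (hind : Indep m₁ m₂ μ) {ι : Type*} (s : Finset ι) {f X : ι → Ω → ℝ}
    (hf : ∀ i ∈ s, AEStronglyMeasurable[m₁] (f i) μ)
    (hX : ∀ i ∈ s, AEStronglyMeasurable[m₂] (X i) μ)
    (hfi : ∀ i ∈ s, Integrable (f i) μ) (hXi : ∀ i ∈ s, Integrable (X i) μ) :
    Integrable (fun ω => ∑ i ∈ s, f i ω * X i ω) μ ∧
    μ[fun ω => ∑ i ∈ s, f i ω * X i ω | m₁] =ᵐ[μ]
      fun ω => ∑ i ∈ s, f i ω * ∫ ω', X i ω' ∂μ := by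
  have hint : ∀ i ∈ s, Integrable (fun ω => f i ω * X i ω) μ := fun i hi =>
    integrable_mul_of_indep hind (hf i hi) (hX i hi) (hfi i hi) (hXi i hi)
  refine ⟨integrable_finsetSum s hint, ?_⟩
  have h1 : μ[∑ i ∈ s, fun ω => f i ω * X i ω | m₁] =ᵐ[μ]
      ∑ i ∈ s, μ[fun ω => f i ω * X i ω | m₁] := condExp_finsetSum hint m₁
  have h2 : ∀ i ∈ s, μ[fun ω => f i ω * X i ω | m₁] =ᵐ[μ]
      fun ω => f i ω * ∫ ω', X i ω' ∂μ := fun i hi => by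
    have e1 : μ[X i | m₁] =ᵐ[μ] fun _ => ∫ ω', X i ω' ∂μ := by
      have e2 := condExp_indep_eq h₂ h₁ (hX i hi).stronglyMeasurable_mk hind.symm
      refine (condExp_congr_ae (hX i hi).ae_eq_mk).trans (e2.trans ?_)
      rw [integral_congr_ae (hX i hi).ae_eq_mk]
    refine (condExp_mul_of_aestronglyMeasurable_left (hf i hi) (hint i hi) (hXi i hi)).trans ?_
    filter_upwards [e1] with ω hω
    simp [hω]
  have h3 : (∑ i ∈ s, fun ω => f i ω * X i ω) = fun ω => ∑ i ∈ s, f i ω * X i ω := by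
    ext ω; simp
  rw [h3] at h1
  have h4 : ∀ᵐ ω ∂μ, ∀ i ∈ s, μ[fun ω => f i ω * X i ω | m₁] ω = f i ω * ∫ ω', X i ω' ∂μ :=
    (Filter.eventually_all_finset s).2 h2
  filter_upwards [h1, h4] with ω hω hω'
  rw [hω, Finset.sum_apply]
  exact Finset.sum_congr rfl hω'

end CondExp

/-! ### Second moments of a solution and means over its field -/

section Solution

variable {Ω : Type*} [MeasurableSpace Ω] {K din dout : ℕ} {M : Model din dout} {μ : Measure Ω}
  {Win : Ω → Euc din} {Wout : Ω → Euc dout} {H B Zh Zb : Ω → C(I, Euc K)}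

/-- The second moments `𝔼[X(s) X(s)ᵀ]` of a random path. -/
def gram (μ : Measure Ω) (X : Ω → C(I, Euc K)) (s : I) : Gram K :=
  fun i j => ∫ ω, X ω s i * X ω s j ∂μ

variable (μ H B Zh Zb) in
/-- The Gram tables of `(H(s), B(s))`, with the value of the field at time `s`. -/
def fieldState (s : I) (ω : Ω) : State K := ((gram μ H s, gram μ B s), (Zh ω s, Zb ω s))

lemma sigmaW_le (hWin : Measurable Win) (hWout : Measurable Wout) :
    sigmaW Win Wout ≤ ‹MeasurableSpace Ω› :=
  (hWin.prodMk hWout).comap_le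

lemma IsLimitField.sigmaZ_le (hF : IsLimitField M μ Win Wout H B Zh Zb) :
    sigmaZ Zh Zb ≤ ‹MeasurableSpace Ω› :=
  iSup_le fun s => ((hF.measurable_h s).prodMk (hF.measurable_b s)).comap_le

lemma continuous_eval_coord (s : I) (i : Fin K) : Continuous fun f : C(I, Euc K) => f s i :=
  (EuclideanSpace.proj (𝕜 := ℝ) i).continuous.comp (continuous_eval_const s)

lemma abs_eval_coord_le (f : C(I, Euc K)) (s : I) (i : Fin K) : |f s i| ≤ ‖f‖ :=
  (PiLp.norm_apply_le (f s) i).trans (f.norm_coe_le_norm s)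

lemma memLp_eval_coord {X : Ω → C(I, Euc K)} {p : ℝ≥0∞} (hX : MemLp X p μ) (s : I) (i : Fin K) :
    MemLp (fun ω => X ω s i) p μ :=
  hX.of_le ((continuous_eval_coord s i).comp_aestronglyMeasurable hX.1)
    (.of_forall fun _ => abs_eval_coord_le _ _ _)

lemma integrable_eval_mul {X : Ω → C(I, Euc K)} (hX : MemLp X 2 μ) (s : I) (i j : Fin K) :
    Integrable (fun ω => X ω s i * X ω s j) μ :=
  (memLp_eval_coord hX s i).integrable_mul (memLp_eval_coord hX s j)

lemma stronglyMeasurable_fieldState {φ : State K → ℝ} (hφ : Measurable φ) (s : I) :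
    StronglyMeasurable[sigmaZ Zh Zb] fun ω => φ (fieldState μ H B Zh Zb s ω) := by
  have h : Measurable[sigmaZ Zh Zb] fun ω => (Zh ω s, Zb ω s) :=
    Measurable.mono (comap_measurable _) (le_iSup (fun s : I =>
      MeasurableSpace.comap (fun ω => (Zh ω s, Zb ω s)) inferInstance) s) le_rfl
  exact (hφ.comp (measurable_const.prodMk h)).stronglyMeasurable

lemma IsLimitField.centered_coord_h (hF : IsLimitField M μ Win Wout H B Zh Zb) (s : I)
    (i : Fin K) : ∫ ω, Zh ω s i ∂μ = 0 := by
  rw [← integral_coord (hF.gaussian.hasGaussianLaw_eval s).fst.integrable, hF.centered_h]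
  rfl

lemma IsLimitField.centered_coord_b (hF : IsLimitField M μ Win Wout H B Zh Zb) (s : I)
    (i : Fin K) : ∫ ω, Zb ω s i ∂μ = 0 := by
  rw [← integral_coord (hF.gaussian.hasGaussianLaw_eval s).snd.integrable, hF.centered_b]
  rfl

/-- The Gram table of a square integrable path is bounded uniformly in time. -/
lemma norm_gram_le {X : Ω → C(I, Euc K)} (hX : MemLp X 2 μ) (s : I) :
    ‖gram μ X s‖ ≤ ∫ ω, ‖X ω‖ ^ 2 ∂μ := by
  have h0 : 0 ≤ ∫ ω, ‖X ω‖ ^ 2 ∂μ := integral_nonneg fun ω => by positivity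
  refine (pi_norm_le_iff_of_nonneg h0).2 fun i => (pi_norm_le_iff_of_nonneg h0).2 fun j => ?_
  refine norm_integral_le_of_norm_le (by simpa using hX.integrable_norm_pow two_ne_zero)
    (.of_forall fun ω => ?_)
  rw [norm_mul, pow_two]
  exact mul_le_mul (abs_eval_coord_le _ _ _) (abs_eval_coord_le _ _ _) (norm_nonneg _)
    (norm_nonneg _)

/-- Functions of polynomial growth of the field are integrable, uniformly in time. -/
lemma IsSolutionWith.exists_integral_bound (hS : IsSolutionWith M μ Win Wout H B Zh Zb)
    {φ : State K → ℝ} (hφ : PolyGrowth φ) :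
    ∃ D : ℝ, ∀ s, Integrable (fun ω => φ (fieldState μ H B Zh Zb s ω)) μ ∧
      |∫ ω, φ (fieldState μ H B Zh Zb s ω) ∂μ| ≤ D := by
  have hF := hS.field
  set A := ∫ ω, ‖H ω‖ ^ 2 ∂μ
  set A' := ∫ ω, ‖B ω‖ ^ 2 ∂μ
  obtain ⟨D, hD⟩ := hφ.exists_integral_bound (μ := μ) (max A A')
    (max (M.sigU ^ 2 * A) (M.sigV ^ 2 * A'))
  have hc : ∀ {X : Ω → C(I, Euc K)}, MemLp X 2 μ → ∀ s i,
      ∫ ω, X ω s i * X ω s i ∂μ ≤ ∫ ω, ‖X ω‖ ^ 2 ∂μ := fun {X} hX s i =>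
    (le_abs_self _).trans (((norm_le_pi_norm (gram μ X s i) i).trans
      (norm_le_pi_norm (gram μ X s) i)).trans (norm_gram_le hX s))
  refine ⟨D, fun s => ?_⟩
  obtain ⟨h1, h2⟩ := hD (gram μ H s, gram μ B s) (fun ω => Zh ω s) (fun ω => Zb ω s)
    (max_le_max (norm_gram_le hS.memLp_H s) (norm_gram_le hS.memLp_B s))
    (hF.gaussian.hasGaussianLaw_eval s) (hF.centered_coord_h s) (hF.centered_coord_b s)
    (fun i => by
      rw [hF.cov_hh]
      exact le_max_of_le_left (mul_le_mul_of_nonneg_left (hc hS.memLp_H s i) (sq_nonneg _)))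
    (fun i => by
      rw [hF.cov_bb]
      exact le_max_of_le_right (mul_le_mul_of_nonneg_left (hc hS.memLp_B s i) (sq_nonneg _)))
  exact ⟨h1, (abs_integral_le_integral_abs).trans h2⟩

lemma IsSolutionWith.integrable_fieldState (hS : IsSolutionWith M μ Win Wout H B Zh Zb)
    {φ : State K → ℝ} (hφ : PolyGrowth φ) (s : I) :
    Integrable (fun ω => φ (fieldState μ H B Zh Zb s ω)) μ :=
  ((hS.exists_integral_bound hφ).choose_spec s).1

/-! ### Expansion of the skeleton maps -/

lemma filter_castSucc_lt (k : Fin K) :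
    (Finset.univ.filter fun i : Fin K => i.castSucc < k.castSucc) = Finset.Iio k := by
  ext i; simp

/-- The skeleton maps are linear in `(H, B)`, with coefficients depending on `(H, B)` only through
its second moments. -/
lemma skeleton_eq (hH : MemLp H 2 μ) (hB : MemLp B 2 μ) (s : I) (zh zb : Euc K)
    (k : Fin (K + 1)) :
    skeleton M μ H B s zh zb k =
      (fun ω => ∑ i with i.castSucc < k,
          coefF M i ((gram μ H s, gram μ B s), (zh, zb)) * H ω s i,
        fun ω => ∑ i with i.castSucc < k,
          coefG M i ((gram μ H s, gram μ B s), (zh, zb)) * B ω s i) := by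
  induction k using Fin.induction with
  | zero => simp [skeleton]
  | succ k ih =>
    have hfil : (Finset.univ.filter fun i : Fin K => i.castSucc < k.succ) =
        insert k (Finset.Iio k) := by
      ext i; simp [Fin.castSucc_lt_succ_iff, le_iff_eq_or_lt]
    rw [filter_castSucc_lt] at ih
    have hint : ∀ {X : Ω → C(I, Euc K)}, MemLp X 2 μ → ∀ c : Fin K → ℝ,
        ∫ ω, X ω s k * ∑ i ∈ Finset.Iio k, c i * X ω s i ∂μ =
          ∑ i ∈ Finset.Iio k, c i * gram μ X s k i := fun {X} hX c => by
      have : ∀ ω, X ω s k * ∑ i ∈ Finset.Iio k, c i * X ω s i =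
          ∑ i ∈ Finset.Iio k, c i * (X ω s k * X ω s i) := fun ω => by
        rw [Finset.mul_sum]
        exact Finset.sum_congr rfl fun i _ => by ring
      simp_rw [this]
      rw [integral_finsetSum _ fun i _ => (integrable_eval_mul hX s k i).const_mul _]
      exact Finset.sum_congr rfl fun i _ => integral_const_mul _ _
    have hstep : skeleton M μ H B s zh zb k.succ =
        (fun ω => (skeleton M μ H B s zh zb k.castSucc).1 ω - M.etaU *
            deriv M.rho (zh k + ∫ ω, H ω s k * (skeleton M μ H B s zh zb k.castSucc).1 ω ∂μ) *
            (zb k + ∫ ω, B ω s k * (skeleton M μ H B s zh zb k.castSucc).2 ω ∂μ) * H ω s k,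
          fun ω => (skeleton M μ H B s zh zb k.castSucc).2 ω - M.etaV *
            M.rho (zh k + ∫ ω, H ω s k * (skeleton M μ H B s zh zb k.castSucc).1 ω ∂μ) *
            B ω s k) := rfl
    rw [hstep, ih, hfil]
    simp only [hint hH, hint hB, Finset.sum_insert (show k ∉ Finset.Iio k by simp)]
    refine Prod.ext (funext fun ω => ?_) (funext fun ω => ?_)
    · simp only
      rw [coefF_eq M k, fieldP, fieldQ]
      ring
    · simp only
      rw [coefG_eq M k, fieldP]
      ring

lemma skelF_eq (hH : MemLp H 2 μ) (hB : MemLp B 2 μ) (k : Fin K) (s : I) (zh zb : Euc K) (ω : Ω) :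
    skelF M μ H B k s zh zb ω =
      ∑ i ∈ Finset.Iio k, coefF M i ((gram μ H s, gram μ B s), (zh, zb)) * H ω s i := by
  rw [skelF, skeleton_eq hH hB, filter_castSucc_lt]

lemma skelG_eq (hH : MemLp H 2 μ) (hB : MemLp B 2 μ) (k : Fin K) (s : I) (zh zb : Euc K) (ω : Ω) :
    skelG M μ H B k s zh zb ω =
      ∑ i ∈ Finset.Iio k, coefG M i ((gram μ H s, gram μ B s), (zh, zb)) * B ω s i := by
  rw [skelG, skeleton_eq hH hB, filter_castSucc_lt]

lemma gradient_apply_coord {f : Euc K → ℝ} (z : Euc K) (j : Fin K) :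
    gradient f z j = fderiv ℝ f z (EuclideanSpace.single j 1) := by
  have h : inner ℝ (gradient f z) (EuclideanSpace.single j (1 : ℝ)) =
      fderiv ℝ f z (EuclideanSpace.single j 1) := by
    simp [gradient]
  rw [← h, EuclideanSpace.inner_single_right]
  simp

lemma gradient_sum_fst {ι : Type*} {s : Finset ι} {φ : ι → State K → ℝ}
    (hφ : ∀ i, SmoothGrowth (φ i)) (c : ι → ℝ) (g : Gram K × Gram K) (zh zb : Euc K) (j : Fin K) :
    gradient (fun z => ∑ i ∈ s, φ i (g, (z, zb)) * c i) zh j =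
      ∑ i ∈ s, fderiv ℝ (fun z => φ i (g, z)) (zh, zb) (EuclideanSpace.single j 1, 0) * c i := by
  have h : ∀ i, HasFDerivAt (fun z => φ i (g, (z, zb)) * c i) (c i •
      (fderiv ℝ (fun z => φ i (g, z)) (zh, zb)).comp (ContinuousLinearMap.inl ℝ _ _)) zh :=
    fun i => (HasFDerivAt.comp (g := fun z => φ i (g, z)) (f := fun z => (z, zb)) zh
      ((hφ i).differentiable g (zh, zb)).hasFDerivAt
      (hasFDerivAt_prodMk_left zh zb)).mul_const (c i)
  rw [gradient_apply_coord, (HasFDerivAt.fun_sum fun i _ => h i).fderiv,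
    sum_apply]
  exact Finset.sum_congr rfl fun i _ => by simp [mul_comm]

lemma gradient_sum_snd {ι : Type*} {s : Finset ι} {φ : ι → State K → ℝ}
    (hφ : ∀ i, SmoothGrowth (φ i)) (c : ι → ℝ) (g : Gram K × Gram K) (zh zb : Euc K) (j : Fin K) :
    gradient (fun z => ∑ i ∈ s, φ i (g, (zh, z)) * c i) zb j =
      ∑ i ∈ s, fderiv ℝ (fun z => φ i (g, z)) (zh, zb) (0, EuclideanSpace.single j 1) * c i := by
  have h : ∀ i, HasFDerivAt (fun z => φ i (g, (zh, z)) * c i) (c i •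
      (fderiv ℝ (fun z => φ i (g, z)) (zh, zb)).comp (ContinuousLinearMap.inr ℝ _ _)) zb :=
    fun i => (HasFDerivAt.comp (g := fun z => φ i (g, z)) (f := fun z => (zh, z)) zb
      ((hφ i).differentiable g (zh, zb)).hasFDerivAt
      (hasFDerivAt_prodMk_right zh zb)).mul_const (c i)
  rw [gradient_apply_coord, (HasFDerivAt.fun_sum fun i _ => h i).fderiv,
    sum_apply]
  exact Finset.sum_congr rfl fun i _ => by simp [mul_comm]

/-! ### Conditional expectations given the field or given the embeddings -/

section

variable [IsProbabilityMeasure μ]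

/-- Given the field, products of coordinates of a path measurable with respect to the embeddings
may be replaced by their means. -/
lemma IsSolutionWith.condExp_sigmaZ (hWin : Measurable Win) (hWout : Measurable Wout)
    (hS : IsSolutionWith M μ Win Wout H B Zh Zb) {X : Ω → C(I, Euc K)}
    (hX : MemLp X 2 μ) (hXW : AEStronglyMeasurable[sigmaW Win Wout] X μ)
    (k : Fin K) (s : I) {φ : Fin K → State K → ℝ} (hφ : ∀ i, PolyGrowth (φ i)) :
    μ[fun ω => X ω s k * ∑ i ∈ Finset.Iio k, φ i (fieldState μ H B Zh Zb s ω) * X ω s i |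
        sigmaZ Zh Zb] =ᵐ[μ]
      fun ω => ∑ i ∈ Finset.Iio k, φ i (fieldState μ H B Zh Zb s ω) * gram μ X s k i := by
  have hc : ∀ i, AEStronglyMeasurable[sigmaW Win Wout] (fun ω => X ω s i) μ := fun i =>
    (continuous_eval_coord s i).comp_aestronglyMeasurable hXW
  have h := (condExp_sum_mul_of_indep (μ := μ) hS.field.sigmaZ_le (sigmaW_le hWin hWout)
    hS.field.indep.symm (Finset.Iio k) (f := fun i ω => φ i (fieldState μ H B Zh Zb s ω))
    (X := fun i ω => X ω s k * X ω s i)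
    (fun i _ => (stronglyMeasurable_fieldState (hφ i).1 s).aestronglyMeasurable)
    (fun i _ => (hc k).mul (hc i)) (fun i _ => hS.integrable_fieldState (hφ i) s)
    (fun i _ => integrable_eval_mul hX s k i)).2
  refine (Filter.EventuallyEq.of_eq (congrArg (fun f => μ[f | sigmaZ Zh Zb])
    (funext fun ω => ?_))).trans h
  rw [Finset.mul_sum]
  exact Finset.sum_congr rfl fun i _ => by ring

/-- Given the embeddings, functions of the field may be replaced by their means. -/
lemma IsSolutionWith.condExp_sigmaW (hWin : Measurable Win) (hWout : Measurable Wout)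
    (hS : IsSolutionWith M μ Win Wout H B Zh Zb) {X : Ω → C(I, Euc K)}
    (hX : MemLp X 2 μ) (hXW : AEStronglyMeasurable[sigmaW Win Wout] X μ)
    (t : Finset (Fin K)) (s : I) {φ : Fin K → State K → ℝ} (hφ : ∀ i, PolyGrowth (φ i)) :
    Integrable (fun ω => ∑ i ∈ t, φ i (fieldState μ H B Zh Zb s ω) * X ω s i) μ ∧
    μ[fun ω => ∑ i ∈ t, φ i (fieldState μ H B Zh Zb s ω) * X ω s i | sigmaW Win Wout] =ᵐ[μ]
      fun ω => ∑ i ∈ t, (∫ ω', φ i (fieldState μ H B Zh Zb s ω') ∂μ) * X ω s i := by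
  have hc : ∀ i, AEStronglyMeasurable[sigmaW Win Wout] (fun ω => X ω s i) μ := fun i =>
    (continuous_eval_coord s i).comp_aestronglyMeasurable hXW
  have h := condExp_sum_mul_of_indep (μ := μ) (sigmaW_le hWin hWout) hS.field.sigmaZ_le
    hS.field.indep t (X := fun i ω => φ i (fieldState μ H B Zh Zb s ω))
    (f := fun i ω => X ω s i) (fun i _ => hc i)
    (fun i _ => (stronglyMeasurable_fieldState (hφ i).1 s).aestronglyMeasurable)
    (fun i _ => (memLp_eval_coord hX s i).integrable one_le_two)
    (fun i _ => hS.integrable_fieldState (hφ i) s)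
  simpa only [mul_comm] using h

/-! ### The drifts as linear combinations of the coordinates -/

lemma IsSolutionWith.preactP_eq (hM : M.Regular) (hWin : Measurable Win) (hWout : Measurable Wout)
    (hS : IsSolutionWith M μ Win Wout H B Zh Zb) (k : Fin K) (s : I) :
    preactP M μ H B Zh Zb k s =ᵐ[μ] fun ω => fieldP M k (fieldState μ H B Zh Zb s ω) := by
  have h := hS.condExp_sigmaZ hWin hWout hS.memLp_H hS.adapted_H k s
    fun i => (smoothGrowth_coefF hM i).growth
  filter_upwards [h] with ω hω
  rw [preactP]
  simp only [skelF_eq hS.memLp_H hS.memLp_B]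
  exact congrArg (Zh ω s k + ·) hω

lemma IsSolutionWith.preactQ_eq (hM : M.Regular) (hWin : Measurable Win) (hWout : Measurable Wout)
    (hS : IsSolutionWith M μ Win Wout H B Zh Zb) (k : Fin K) (s : I) :
    preactQ M μ H B Zh Zb k s =ᵐ[μ] fun ω => fieldQ M k (fieldState μ H B Zh Zb s ω) := by
  have h := hS.condExp_sigmaZ hWin hWout hS.memLp_B hS.adapted_B k s
    fun i => (smoothGrowth_coefG hM i).growth
  filter_upwards [h] with ω hω
  rw [preactQ]
  simp only [skelG_eq hS.memLp_H hS.memLp_B]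
  exact congrArg (Zb ω s k + ·) hω

lemma IsSolutionWith.respHFb_eq (hM : M.Regular) (hWin : Measurable Win) (hWout : Measurable Wout)
    (hS : IsSolutionWith M μ Win Wout H B Zh Zb) (k : Fin K) (s : I) (j : Fin K) :
    respHFb M μ H B Zh Zb k s j =ᵐ[μ] fun ω => ∑ i ∈ Finset.Iio k,
      dbCoefF M i j (fieldState μ H B Zh Zb s ω) * gram μ H s k i := by
  rw [respHFb]
  simp only [skelF_eq hS.memLp_H hS.memLp_B, gradient_sum_snd (smoothGrowth_coefF hM)]
  exact hS.condExp_sigmaZ hWin hWout hS.memLp_H hS.adapted_H k s fun i => polyGrowth_dbCoefF hM i j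

lemma IsSolutionWith.respHFh_eq (hM : M.Regular) (hWin : Measurable Win) (hWout : Measurable Wout)
    (hS : IsSolutionWith M μ Win Wout H B Zh Zb) (k : Fin K) (s : I) (j : Fin K) :
    respHFh M μ H B Zh Zb k s j =ᵐ[μ] fun ω => ∑ i ∈ Finset.Iio k,
      dhCoefF M i j (fieldState μ H B Zh Zb s ω) * gram μ H s k i := by
  rw [respHFh]
  simp only [skelF_eq hS.memLp_H hS.memLp_B, gradient_sum_fst (smoothGrowth_coefF hM)]
  exact hS.condExp_sigmaZ hWin hWout hS.memLp_H hS.adapted_H k s fun i => polyGrowth_dhCoefF hM i j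

lemma IsSolutionWith.respBGh_eq (hM : M.Regular) (hWin : Measurable Win) (hWout : Measurable Wout)
    (hS : IsSolutionWith M μ Win Wout H B Zh Zb) (k : Fin K) (s : I) (j : Fin K) :
    respBGh M μ H B Zh Zb k s j =ᵐ[μ] fun ω => ∑ i ∈ Finset.Iio k,
      dhCoefG M i j (fieldState μ H B Zh Zb s ω) * gram μ B s k i := by
  rw [respBGh]
  simp only [skelG_eq hS.memLp_H hS.memLp_B, gradient_sum_fst (smoothGrowth_coefG hM)]
  exact hS.condExp_sigmaZ hWin hWout hS.memLp_B hS.adapted_B k s fun i => polyGrowth_dhCoefG hM i j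

/-- The drift of `H_k` is, by independence of the field and the embeddings, a deterministic linear combination of `B_0, …, B_{k-1}`. -/
lemma IsSolutionWith.driftH_eq (hM : M.Regular) (hWin : Measurable Win) (hWout : Measurable Wout)
    (hS : IsSolutionWith M μ Win Wout H B Zh Zb) (k : Fin K) (s : I) :
    driftH M μ Win Wout H B Zh Zb k s =ᵐ[μ] fun ω => ∑ j ∈ Finset.Iio k,
      (∫ ω', kernelH M k j (fieldState μ H B Zh Zb s ω') ∂μ) * B ω s j := by
  set u := fieldState μ H B Zh Zb s with hu
  have hP := hS.preactP_eq hM hWin hWout k s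
  have h1 : ∀ j, ∫ ω', deriv M.rho (preactP M μ H B Zh Zb k s ω') *
      respHFb M μ H B Zh Zb k s j ω' ∂μ = ∫ ω', deriv M.rho (fieldP M k (u ω')) *
        ∑ i ∈ Finset.Iio k, dbCoefF M i j (u ω') * (u ω').1.1 k i ∂μ := fun j => by
    refine integral_congr_ae ?_
    filter_upwards [hP, hS.respHFb_eq hM hWin hWout k s j] with ω hω hω'
    rw [hω, hω']
    rfl
  have h2 := (hS.condExp_sigmaW hWin hWout hS.memLp_B hS.adapted_B (Finset.Iio k) s
    fun j => polyGrowth_rho_mul_coefG hM k j).2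
  have h3 : μ[fun ω' => M.rho (preactP M μ H B Zh Zb k s ω') *
        skelG M μ H B k s (Zh ω' s) (Zb ω' s) ω' | sigmaW Win Wout] =ᵐ[μ]
      fun ω => ∑ j ∈ Finset.Iio k,
        (∫ ω', M.rho (fieldP M k (u ω')) * coefG M j (u ω') ∂μ) * B ω s j := by
    refine (condExp_congr_ae ?_).trans h2
    filter_upwards [hP] with ω hω
    rw [hω, skelG_eq hS.memLp_H hS.memLp_B, Finset.mul_sum]
    exact Finset.sum_congr rfl fun j _ => by rw [mul_assoc]; rfl
  filter_upwards [h3] with ω hω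
  rw [driftH, hω, Finset.mul_sum, ← Finset.sum_add_distrib]
  refine Finset.sum_congr rfl fun j _ => ?_
  rw [h1]
  have e : ∫ ω', kernelH M k j (u ω') ∂μ =
      M.sigV ^ 2 * (∫ ω', deriv M.rho (fieldP M k (u ω')) *
        ∑ i ∈ Finset.Iio k, dbCoefF M i j (u ω') * (u ω').1.1 k i ∂μ) +
      ∫ ω', M.rho (fieldP M k (u ω')) * coefG M j (u ω') ∂μ := by
    simp only [kernelH]
    rw [integral_add ((hS.integrable_fieldState
      ((polyGrowth_deriv_fieldP hM k).mul (polyGrowth_respHFb hM k j)) s).const_mul _)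
      (hS.integrable_fieldState (polyGrowth_rho_mul_coefG hM k j) s), integral_const_mul]
  rw [e]
  ring

/-- The drift of `B_k` is a deterministic linear combination of `H_0, …, H_k`. -/
lemma IsSolutionWith.driftB_eq (hM : M.Regular) (hWin : Measurable Win) (hWout : Measurable Wout)
    (hS : IsSolutionWith M μ Win Wout H B Zh Zb) (k : Fin K) (s : I) :
    driftB M μ Win Wout H B Zh Zb k s =ᵐ[μ] fun ω => (∑ j ∈ Finset.Iio k,
      (∫ ω', kernelB M k j (fieldState μ H B Zh Zb s ω') ∂μ) * H ω s j) +
      (∫ ω', kernelBDiag M k (fieldState μ H B Zh Zb s ω') ∂μ) * H ω s k := by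
  set u := fieldState μ H B Zh Zb s with hu
  have hP := hS.preactP_eq hM hWin hWout k s
  have hQ := hS.preactQ_eq hM hWin hWout k s
  have g1 : ∀ j, PolyGrowth fun v => deriv M.rho (fieldP M k v) * coefF M j v * fieldQ M k v :=
    fun j => ((polyGrowth_deriv_fieldP hM k).mul (smoothGrowth_coefF hM j).growth).mul
      (smoothGrowth_fieldQ hM k).growth
  have g2 : ∀ j, PolyGrowth fun v => deriv M.rho (fieldP M k v) *
      ∑ i ∈ Finset.Iio k, dhCoefG M i j v * v.1.2 k i :=
    fun j => (polyGrowth_deriv_fieldP hM k).mul (polyGrowth_respBGh hM k j)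
  have g3 : ∀ j, PolyGrowth fun v => deriv (deriv M.rho) (fieldP M k v) * fieldQ M k v *
      ∑ i ∈ Finset.Iio k, dhCoefF M i j v * v.1.1 k i :=
    fun j => (polyGrowth_deriv2_fieldP_mul hM k).mul (polyGrowth_respHFh hM k j)
  have g4 := polyGrowth_deriv2_fieldP_mul hM k
  have h1 : ∀ j, ∫ ω', deriv M.rho (preactP M μ H B Zh Zb k s ω') *
      respBGh M μ H B Zh Zb k s j ω' ∂μ = ∫ ω', deriv M.rho (fieldP M k (u ω')) *
        ∑ i ∈ Finset.Iio k, dhCoefG M i j (u ω') * (u ω').1.2 k i ∂μ := fun j => by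
    refine integral_congr_ae ?_
    filter_upwards [hP, hS.respBGh_eq hM hWin hWout k s j] with ω hω hω'
    rw [hω, hω']
    rfl
  have h2 : μ[fun ω' => deriv M.rho (preactP M μ H B Zh Zb k s ω') *
        skelF M μ H B k s (Zh ω' s) (Zb ω' s) ω' * preactQ M μ H B Zh Zb k s ω' |
        sigmaW Win Wout] =ᵐ[μ] fun ω => ∑ j ∈ Finset.Iio k,
        (∫ ω', deriv M.rho (fieldP M k (u ω')) * coefF M j (u ω') * fieldQ M k (u ω') ∂μ) *
          H ω s j := by
    refine (condExp_congr_ae ?_).trans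
      (hS.condExp_sigmaW hWin hWout hS.memLp_H hS.adapted_H (Finset.Iio k) s g1).2
    filter_upwards [hP, hQ] with ω hω hω'
    rw [hω, hω', skelF_eq hS.memLp_H hS.memLp_B, Finset.mul_sum, Finset.sum_mul]
    refine Finset.sum_congr rfl fun j _ => ?_
    rw [show ((gram μ H s, gram μ B s), (Zh ω s, Zb ω s)) = u ω from rfl]
    ring
  have h3 : μ[fun ω' => deriv (deriv M.rho) (preactP M μ H B Zh Zb k s ω') *
          preactQ M μ H B Zh Zb k s ω' *
          (H ω' s k + ∑ j ∈ Finset.Iio k, respHFh M μ H B Zh Zb k s j ω' * H ω' s j)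
            | sigmaW Win Wout] =ᵐ[μ] fun ω =>
      (∫ ω', deriv (deriv M.rho) (fieldP M k (u ω')) * fieldQ M k (u ω') ∂μ) * H ω s k +
      ∑ j ∈ Finset.Iio k, (∫ ω', deriv (deriv M.rho) (fieldP M k (u ω')) * fieldQ M k (u ω') *
        ∑ i ∈ Finset.Iio k, dhCoefF M i j (u ω') * (u ω').1.1 k i ∂μ) * H ω s j := by
    obtain ⟨i1, e1⟩ := hS.condExp_sigmaW hWin hWout hS.memLp_H hS.adapted_H {k} s fun _ => g4
    obtain ⟨i2, e2⟩ := hS.condExp_sigmaW hWin hWout hS.memLp_H hS.adapted_H (Finset.Iio k) s g3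
    simp only [Finset.sum_singleton] at i1 e1
    refine (condExp_congr_ae ?_).trans ((condExp_add i1 i2 _).trans (e1.add e2))
    have hr : ∀ᵐ ω ∂μ, ∀ j ∈ Finset.Iio k, respHFh M μ H B Zh Zb k s j ω =
        ∑ i ∈ Finset.Iio k, dhCoefF M i j (u ω) * gram μ H s k i :=
      (Filter.eventually_all_finset _).2 fun j _ => hS.respHFh_eq hM hWin hWout k s j
    filter_upwards [hP, hQ, hr] with ω hω hω' hωr
    rw [hω, hω', Finset.sum_congr rfl fun j hj => by rw [hωr j hj], mul_add, Finset.mul_sum,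
      Pi.add_apply]
    congr 1
    exact Finset.sum_congr rfl fun j _ => (mul_assoc _ _ _).symm
  filter_upwards [h2, h3] with ω hω hω'
  rw [driftB, hω, hω']
  have e : ∀ j, ∫ ω', kernelB M k j (u ω') ∂μ =
      -(∫ ω', deriv M.rho (fieldP M k (u ω')) * coefF M j (u ω') * fieldQ M k (u ω') ∂μ) -
      M.sigU ^ 2 * (∫ ω', deriv M.rho (fieldP M k (u ω')) *
        ∑ i ∈ Finset.Iio k, dhCoefG M i j (u ω') * (u ω').1.2 k i ∂μ) -
      M.sigU ^ 2 * ∫ ω', deriv (deriv M.rho) (fieldP M k (u ω')) * fieldQ M k (u ω') *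
        ∑ i ∈ Finset.Iio k, dhCoefF M i j (u ω') * (u ω').1.1 k i ∂μ := fun j => by
    simp only [kernelB]
    rw [integral_sub, integral_sub, integral_neg, integral_const_mul, integral_const_mul]
    · exact (hS.integrable_fieldState (g1 j) s).neg
    · exact (hS.integrable_fieldState (g2 j) s).const_mul _
    · exact (hS.integrable_fieldState (g1 j) s).neg.sub
        ((hS.integrable_fieldState (g2 j) s).const_mul _)
    · exact (hS.integrable_fieldState (g3 j) s).const_mul _
  simp only [h1, e, kernelBDiag, integral_neg, integral_const_mul, sub_mul, neg_mul,
    Finset.sum_sub_distrib, Finset.sum_neg_distrib, Finset.mul_sum, mul_add, mul_assoc]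
  ring

end

end Solution

/-! ### The linear system for the matrices -/

section Rows

variable {K din dout : ℕ} (M : Model din dout)

/-- The mean of `φ(g, Z)` under the limit law, where only the block of indices `0, …, k` of the
Gram tables `g` is used. -/
def driftCoef (φ : State K → ℝ) (k : Fin K) (g : Gram K × Gram K) : ℝ :=
  ∫ z, φ ((truncGram k g.1, truncGram k g.2), z) ∂limitLaw M (truncGram k g.1, truncGram k g.2)

/-- `driftCoef` along a path of Gram tables, extended from `[0,1]` to `ℝ` by constants. -/
def driftCoefAt (φ : State K → ℝ) (k : Fin K) (GH GB : I → Gram K) (r : ℝ) : ℝ :=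
  driftCoef M φ k
    (GH (Set.projIcc 0 1 zero_le_one r), GB (Set.projIcc 0 1 zero_le_one r))

/-- The rows of the matrices representing `H_k` and `B_k` as linear functions of the embeddings. They
solve the deterministic linear system obtained from the limit system by replacing each path by its
row. -/
def rowPair (GH GB : I → Gram K) (y : Fin K → Euc dout) (k : Fin K) :
    (ℝ → Fin din ⊕ Fin dout → ℝ) × (ℝ → Fin din ⊕ Fin dout → ℝ) :=
  let row : ℝ → Fin din ⊕ Fin dout → ℝ := fun s => Sum.elim M.x.ofLp (0 : Fin dout → ℝ) +
    ∫ r in (0 : ℝ)..s, ∑ j ∈ (Finset.Iio k).attach,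
      driftCoefAt M (kernelH M k j.1) k GH GB r • (rowPair GH GB y j.1).2 r
  (row, fun s => Sum.elim (0 : Fin din → ℝ) (gradient M.loss (y k)).ofLp -
    ∫ r in s..1, ((∑ j ∈ (Finset.Iio k).attach,
      driftCoefAt M (kernelB M k j.1) k GH GB r • (rowPair GH GB y j.1).1 r) +
      driftCoefAt M (kernelBDiag M k) k GH GB r • row r))
termination_by k
decreasing_by all_goals exact Fin.lt_def.1 (Finset.mem_Iio.1 j.2)

/-- The row representing `H_k`. -/
def rowH (GH GB : I → Gram K) (y : Fin K → Euc dout) (k : Fin K) :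
    ℝ → Fin din ⊕ Fin dout → ℝ := (rowPair M GH GB y k).1

/-- The row representing `B_k`. -/
def rowB (GH GB : I → Gram K) (y : Fin K → Euc dout) (k : Fin K) :
    ℝ → Fin din ⊕ Fin dout → ℝ := (rowPair M GH GB y k).2

variable (GH GB : I → Gram K) (y : Fin K → Euc dout)

lemma rowH_eq (k : Fin K) (s : ℝ) : rowH M GH GB y k s = Sum.elim M.x.ofLp (0 : Fin dout → ℝ) +
    ∫ r in (0 : ℝ)..s, ∑ j ∈ Finset.Iio k,
      driftCoefAt M (kernelH M k j) k GH GB r • rowB M GH GB y j r := by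
  have h : ∀ r, ∑ j ∈ (Finset.Iio k).attach,
      driftCoefAt M (kernelH M k j.1) k GH GB r • (rowPair M GH GB y j.1).2 r =
      ∑ j ∈ Finset.Iio k, driftCoefAt M (kernelH M k j) k GH GB r • rowB M GH GB y j r := fun r =>
    Finset.sum_attach (Finset.Iio k)
      (fun j => driftCoefAt M (kernelH M k j) k GH GB r • rowB M GH GB y j r)
  rw [rowH, rowPair]
  simp only [h]

lemma rowB_eq (k : Fin K) (s : ℝ) : rowB M GH GB y k s =
    Sum.elim (0 : Fin din → ℝ) (gradient M.loss (y k)).ofLp -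
    ∫ r in s..1, ((∑ j ∈ Finset.Iio k,
      driftCoefAt M (kernelB M k j) k GH GB r • rowH M GH GB y j r) +
      driftCoefAt M (kernelBDiag M k) k GH GB r • rowH M GH GB y k r) := by
  have h : ∀ r, ∑ j ∈ (Finset.Iio k).attach,
      driftCoefAt M (kernelB M k j.1) k GH GB r • (rowPair M GH GB y j.1).1 r =
      ∑ j ∈ Finset.Iio k, driftCoefAt M (kernelB M k j) k GH GB r • rowH M GH GB y j r := fun r =>
    Finset.sum_attach (Finset.Iio k)
      (fun j => driftCoefAt M (kernelB M k j) k GH GB r • rowH M GH GB y j r)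
  simp only [rowB, rowH] at h ⊢
  rw [rowPair]
  simp only [h]

end Rows

/-! ### Representation of a solution -/

section Representation

variable {Ω : Type*} [MeasurableSpace Ω] {K din dout : ℕ} {M : Model din dout} {μ : Measure Ω}
  {Win : Ω → Euc din} {Wout : Ω → Euc dout} {H B Zh Zb : Ω → C(I, Euc K)}

lemma truncGram_truncGram {j k : Fin K} (h : j ≤ k) (g : Gram K) :
    truncGram j (truncGram k g) = truncGram j g := by
  funext a b
  by_cases hab : a ≤ j ∧ b ≤ j
  · simp [truncGram, hab, hab.1.trans h, hab.2.trans h]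
  · simp [truncGram, hab]

/-- The mean of a function of the field depending only on the indices `0, …, k`. -/
lemma IsSolutionWith.integral_eq_driftCoef (hS : IsSolutionWith M μ Win Wout H B Zh Zb)
    {φ : State K → ℝ} (hφ : Measurable φ) {k : Fin K} (hk : ∀ u, φ (truncState k u) = φ u)
    (s : I) :
    ∫ ω, φ (fieldState μ H B Zh Zb s ω) ∂μ = driftCoef M φ k (gram μ H s, gram μ B s) := by
  have hF := hS.field
  have hZ := hF.gaussian.hasGaussianLaw_eval s
  have hlaw : μ.map (fun ω => (truncVec k (Zh ω s), truncVec k (Zb ω s))) =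
      limitLaw M (truncGram k (gram μ H s), truncGram k (gram μ B s)) := by
    refine map_eq_limitLaw (hZ.map_fun (truncPair k)) (fun i => ?_) (fun i => ?_)
      (fun i j => ?_) (fun i j => ?_) (fun i j => ?_)
    · by_cases hi : i ≤ k <;> simp [hi, hF.centered_coord_h]
    · by_cases hi : i ≤ k <;> simp [hi, hF.centered_coord_b]
    · by_cases hi : i ≤ k <;> by_cases hj : j ≤ k <;>
        simp [hi, hj, truncGram, hF.cov_hh, gram]
    · by_cases hi : i ≤ k <;> by_cases hj : j ≤ k <;>
        simp [hi, hj, truncGram, hF.cov_bb, gram]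
    · by_cases hi : i ≤ k <;> by_cases hj : j ≤ k <;> simp [hi, hj, hF.cov_hb]
  have hae : AEMeasurable (fun ω => (truncVec k (Zh ω s), truncVec k (Zb ω s))) μ :=
    (hZ.map_fun (truncPair k)).aemeasurable
  rw [driftCoef, ← hlaw, integral_map hae
    (f := fun z => φ ((truncGram k (gram μ H s), truncGram k (gram μ B s)), z))
    (hφ.comp measurable_prodMk_left).aestronglyMeasurable]
  exact integral_congr_ae (.of_forall fun ω => (hk _).symm)

lemma continuous_gram {X : Ω → C(I, Euc K)} (hX : MemLp X 2 μ) : Continuous (gram μ X) := by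
  refine continuous_pi fun i => continuous_pi fun j => ?_
  refine continuous_of_dominated (bound := fun ω => ‖X ω‖ ^ 2)
    (fun s => (integrable_eval_mul hX s i j).1) (fun s => .of_forall fun ω => ?_)
    (by simpa using hX.integrable_norm_pow two_ne_zero) (.of_forall fun ω => ?_)
  · rw [norm_mul, pow_two]
    exact mul_le_mul (abs_eval_coord_le _ _ _) (abs_eval_coord_le _ _ _) (norm_nonneg _)
      (norm_nonneg _)
  · exact ((EuclideanSpace.proj (𝕜 := ℝ) i).continuous.comp (X ω).continuous).mul
      ((EuclideanSpace.proj (𝕜 := ℝ) j).continuous.comp (X ω).continuous)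

lemma IsSolutionWith.measurable_fieldState (hS : IsSolutionWith M μ Win Wout H B Zh Zb) :
    Measurable (Function.uncurry fun (s : I) ω => fieldState μ H B Zh Zb s ω) := by
  have hF := hS.field
  have h1 : Measurable (Function.uncurry fun (s : I) ω => Zh ω s) :=
    measurable_uncurry_of_continuous_of_measurable (fun ω => (Zh ω).continuous) hF.measurable_h
  have h2 : Measurable (Function.uncurry fun (s : I) ω => Zb ω s) :=
    measurable_uncurry_of_continuous_of_measurable (fun ω => (Zb ω).continuous) hF.measurable_b
  exact (((continuous_gram hS.memLp_H).measurable.comp measurable_fst).prodMk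
    ((continuous_gram hS.memLp_B).measurable.comp measurable_fst)).prodMk (h1.prodMk h2)

/-- Along a solution, the coefficients of the linear system are means over the field; they are
measurable and bounded, hence locally integrable in time. -/
lemma IsSolutionWith.driftCoefAt_spec [IsProbabilityMeasure μ]
    (hS : IsSolutionWith M μ Win Wout H B Zh Zb)
    {φ : State K → ℝ} (hφ : PolyGrowth φ) {k : Fin K} (hk : ∀ u, φ (truncState k u) = φ u)
    {GH GB : I → Gram K} (hGH : ∀ s, truncGram k (GH s) = truncGram k (gram μ H s))
    (hGB : ∀ s, truncGram k (GB s) = truncGram k (gram μ B s)) :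
    (∀ s : I, driftCoefAt M φ k GH GB s = ∫ ω, φ (fieldState μ H B Zh Zb s ω) ∂μ) ∧
    Measurable (driftCoefAt M φ k GH GB) ∧
    ∀ a b, IntervalIntegrable (driftCoefAt M φ k GH GB) volume a b := by
  have h1 : ∀ r : ℝ, driftCoefAt M φ k GH GB r =
      ∫ ω, φ (fieldState μ H B Zh Zb (Set.projIcc 0 1 zero_le_one r) ω) ∂μ := fun r => by
    rw [hS.integral_eq_driftCoef hφ.1 hk, driftCoefAt, driftCoef, driftCoef]
    simp only [hGH, hGB]
  have hm : Measurable (driftCoefAt M φ k GH GB) := by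
    rw [funext h1]
    have hI : StronglyMeasurable fun s : I => ∫ ω, φ (fieldState μ H B Zh Zb s ω) ∂μ :=
      (hφ.1.comp hS.measurable_fieldState).stronglyMeasurable.integral_prod_right'
        (ν := μ) (f := fun p : I × Ω => φ (fieldState μ H B Zh Zb p.1 p.2))
    exact hI.measurable.comp continuous_projIcc.measurable
  refine ⟨fun s => by rw [h1, Set.projIcc_val], hm, fun a b => ?_⟩
  obtain ⟨D, hD⟩ := hS.exists_integral_bound hφ
  refine (intervalIntegrable_const (c := D)).mono_fun hm.aestronglyMeasurable
    (.of_forall fun r => ?_)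
  simp only [h1, Real.norm_eq_abs]
  exact (hD _).2.trans (le_abs_self D)

lemma intervalIntegrable_sum {ι E : Type*} [NormedAddCommGroup E] (s : Finset ι) {f : ι → ℝ → E}
    {a b : ℝ} (h : ∀ i ∈ s, IntervalIntegrable (f i) volume a b) :
    IntervalIntegrable (fun r => ∑ i ∈ s, f i r) volume a b := by
  simpa only [Finset.sum_fn] using IntervalIntegrable.sum s h

/-- If `D(r) = R(r) · W` almost surely for every `r ∈ [0,1]`, with `R` deterministic, then almost
surely the same relation holds between all time integrals of `D` and of `R`. -/
lemma ae_integral_eq_dotProduct [SFinite μ] {ι : Type*} [Fintype ι] {D : ℝ → Ω → ℝ} {R : ℝ → ι → ℝ}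
    {W : Ω → ι → ℝ} (hD : Measurable (Function.uncurry D)) (hR : Measurable R)
    (hRi : ∀ a b, IntervalIntegrable R volume a b) (hW : Measurable W)
    (h : ∀ s : I, D s =ᵐ[μ] fun ω => R s ⬝ᵥ W ω) :
    ∀ᵐ ω ∂μ, ∀ s t : I, ∫ r in (s : ℝ)..t, D r ω = (∫ r in (s : ℝ)..t, R r) ⬝ᵥ W ω := by
  have hset : MeasurableSet {x : ℝ × Ω | D x.1 x.2 = R x.1 ⬝ᵥ W x.2} := by
    refine measurableSet_eq_fun hD ?_
    simp only [dotProduct]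
    fun_prop
  -- Fubini: for almost every path the relation holds at almost every time.
  have h1 : ∀ᵐ r ∂(volume.restrict (Set.Icc (0 : ℝ) 1)), ∀ᵐ ω ∂μ, D r ω = R r ⬝ᵥ W ω :=
    (ae_restrict_iff' measurableSet_Icc).2 (.of_forall fun r hr => h ⟨r, hr⟩)
  rw [Measure.ae_ae_comm hset] at h1
  filter_upwards [h1] with ω hω s t
  let L : (ι → ℝ) →L[ℝ] ℝ := ∑ i, W ω i • ContinuousLinearMap.proj i
  have hL : ∀ v, L v = v ⬝ᵥ W ω := fun v => by
    simp [L, dotProduct, mul_comm]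
  rw [← hL, ← L.intervalIntegral_comp_comm (hRi _ _)]
  refine intervalIntegral.integral_congr_ae_restrict ?_
  have hsub : Set.uIoc (s : ℝ) t ⊆ Set.Icc 0 1 := fun r hr =>
    ⟨(le_min s.2.1 t.2.1).trans hr.1.le, hr.2.trans (max_le s.2.2 t.2.2)⟩
  filter_upwards [ae_restrict_of_ae_restrict_of_subset hsub hω] with r hr
  rw [hr, hL]

/-- The representation of `(H_k, B_k)`, when `(GH, GB)` agrees with the second moments of the
solution on the indices `0, …, k` and `y` agrees with the outputs. -/
theorem IsSolutionWith.row_spec [IsProbabilityMeasure μ] (hM : M.Regular) (hWin : Measurable Win)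
    (hWout : Measurable Wout) (hS : IsSolutionWith M μ Win Wout H B Zh Zb)
    {GH GB : I → Gram K} {y : Fin K → Euc dout} (k : Fin K)
    (hGH : ∀ s, truncGram k (GH s) = truncGram k (gram μ H s))
    (hGB : ∀ s, truncGram k (GB s) = truncGram k (gram μ B s))
    (hy : ∀ j < k, y j = output μ Wout H j) :
    (Continuous (rowH M GH GB y k) ∧ ∀ᵐ ω ∂μ, ∀ s : I,
      H ω s k = rowH M GH GB y k s ⬝ᵥ Sum.elim (Win ω) (Wout ω)) ∧
    (y k = output μ Wout H k → Continuous (rowB M GH GB y k) ∧ ∀ᵐ ω ∂μ, ∀ s : I,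
      B ω s k = rowB M GH GB y k s ⬝ᵥ Sum.elim (Win ω) (Wout ω)) := by
  induction k using WellFoundedLT.induction with
  | ind k ih =>
  have hW : Measurable fun ω => Sum.elim (Win ω) (Wout ω) := by
    refine measurable_pi_iff.2 fun l => ?_
    cases l <;> simp <;> fun_prop
  have ihj : ∀ j < k, _ := fun j hj => ih j hj
    (fun s => by rw [← truncGram_truncGram hj.le, hGH, truncGram_truncGram hj.le])
    (fun s => by rw [← truncGram_truncGram hj.le, hGB, truncGram_truncGram hj.le])
    (fun i hi => hy i (hi.trans hj))
  have hcH : ∀ j < k, Continuous (rowH M GH GB y j) := fun j hj => (ihj j hj).1.1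
  have hcB : ∀ j < k, Continuous (rowB M GH GB y j) := fun j hj => ((ihj j hj).2 (hy j hj)).1
  have spH : ∀ j < k, _ := fun j hj => hS.driftCoefAt_spec (polyGrowth_kernelH hM k j)
    (fun u => (kernel_truncState hM (k := k) hj.le u).1) hGH hGB
  have spB : ∀ j < k, _ := fun j hj => hS.driftCoefAt_spec (polyGrowth_kernelB hM k j)
    (fun u => (kernel_truncState hM (k := k) hj.le u).2.1) hGH hGB
  have spD := hS.driftCoefAt_spec (polyGrowth_kernelBDiag hM k)
    (fun u => (kernel_truncState hM (k := k) le_rfl u).2.2) hGH hGB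
  -- The drift of `B_k` contains `H_k` itself, so `H_k` has to be represented first.
  have main_H : Continuous (rowH M GH GB y k) ∧ ∀ᵐ ω ∂μ, ∀ s : I,
      H ω s k = rowH M GH GB y k s ⬝ᵥ Sum.elim (Win ω) (Wout ω) := by
    set R : ℝ → Fin din ⊕ Fin dout → ℝ := fun r => ∑ j ∈ Finset.Iio k,
      driftCoefAt M (kernelH M k j) k GH GB r • rowB M GH GB y j r with hR
    have hRm : Measurable R := Finset.measurable_fun_sum _ fun j hj =>
      (spH j (Finset.mem_Iio.1 hj)).2.1.smul (hcB j (Finset.mem_Iio.1 hj)).measurable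
    have hRi : ∀ a b, IntervalIntegrable R volume a b := fun a b =>
      intervalIntegrable_sum _ fun j hj => ((spH j (Finset.mem_Iio.1 hj)).2.2 a b).smul_continuousOn
        (hcB j (Finset.mem_Iio.1 hj)).continuousOn
    have hrow : ∀ s, rowH M GH GB y k s = Sum.elim M.x.ofLp (0 : Fin dout → ℝ) + ∫ r in (0 : ℝ)..s, R r :=
      fun s => rowH_eq M GH GB y k s
    refine ⟨?_, ?_⟩
    · rw [funext hrow]
      exact continuous_const.add (intervalIntegral.continuous_primitive hRi 0)
    · obtain ⟨D, hD, hDe, hDi⟩ := hS.eq_H k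
      have hrep : ∀ s : I, D s =ᵐ[μ] fun ω => R s ⬝ᵥ Sum.elim (Win ω) (Wout ω) := fun s => by
        have hB' : ∀ᵐ ω ∂μ, ∀ j ∈ Finset.Iio k,
            B ω s j = rowB M GH GB y j s ⬝ᵥ Sum.elim (Win ω) (Wout ω) :=
          (Filter.eventually_all_finset _).2 fun j hj =>
            ((ihj j (Finset.mem_Iio.1 hj)).2 (hy j (Finset.mem_Iio.1 hj))).2.mono fun ω h => h s
        filter_upwards [hDe s, hS.driftH_eq hM hWin hWout k s, hB'] with ω h1 h2 h3
        rw [h1, h2, hR, sum_dotProduct]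
        refine Finset.sum_congr rfl fun j hj => ?_
        rw [h3 j hj, (spH j (Finset.mem_Iio.1 hj)).1 s, smul_dotProduct, smul_eq_mul]
      filter_upwards [hDi, ae_integral_eq_dotProduct hD hRm hRi hW hrep] with ω h1 h2 s
      have := h2 0 s
      simp only [Set.Icc.coe_zero] at this
      rw [h1.2 s, hrow, add_dotProduct, this]
      simp [dotProduct, PiLp.inner_apply]
  refine ⟨main_H, fun hyk => ?_⟩
  set R : ℝ → Fin din ⊕ Fin dout → ℝ := fun r => (∑ j ∈ Finset.Iio k,
    driftCoefAt M (kernelB M k j) k GH GB r • rowH M GH GB y j r) +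
    driftCoefAt M (kernelBDiag M k) k GH GB r • rowH M GH GB y k r with hR
  have hRm : Measurable R := (Finset.measurable_fun_sum _ fun j hj =>
    (spB j (Finset.mem_Iio.1 hj)).2.1.smul (hcH j (Finset.mem_Iio.1 hj)).measurable).add
    (spD.2.1.smul main_H.1.measurable)
  have hRi : ∀ a b, IntervalIntegrable R volume a b := fun a b =>
    (intervalIntegrable_sum _ fun j hj => ((spB j (Finset.mem_Iio.1 hj)).2.2 a b).smul_continuousOn
      (hcH j (Finset.mem_Iio.1 hj)).continuousOn).add
    ((spD.2.2 a b).smul_continuousOn main_H.1.continuousOn)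
  have hrow : ∀ s, rowB M GH GB y k s =
      Sum.elim (0 : Fin din → ℝ) (gradient M.loss (y k)).ofLp - ∫ r in s..1, R r := fun s => rowB_eq M GH GB y k s
  refine ⟨?_, ?_⟩
  · rw [funext hrow]
    simp only [intervalIntegral.integral_symm (1 : ℝ)]
    exact continuous_const.sub (intervalIntegral.continuous_primitive hRi 1).neg
  · obtain ⟨D, hD, hDe, hDi⟩ := hS.eq_B k
    have hrep : ∀ s : I, D s =ᵐ[μ] fun ω => R s ⬝ᵥ Sum.elim (Win ω) (Wout ω) := fun s => by
      have hH' : ∀ᵐ ω ∂μ, ∀ j ∈ Finset.Iio k,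
          H ω s j = rowH M GH GB y j s ⬝ᵥ Sum.elim (Win ω) (Wout ω) :=
        (Filter.eventually_all_finset _).2 fun j hj =>
          (ihj j (Finset.mem_Iio.1 hj)).1.2.mono fun ω h => h s
      filter_upwards [hDe s, hS.driftB_eq hM hWin hWout k s, hH', main_H.2] with ω h1 h2 h3 h4
      rw [h1, h2, hR, add_dotProduct, sum_dotProduct, h4 s, spD.1 s, smul_dotProduct, smul_eq_mul]
      congr 1
      refine Finset.sum_congr rfl fun j hj => ?_
      rw [h3 j hj, (spB j (Finset.mem_Iio.1 hj)).1 s, smul_dotProduct, smul_eq_mul]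
    filter_upwards [hDi, ae_integral_eq_dotProduct hD hRm hRi hW hrep] with ω h1 h2 s
    have := h2 s 1
    simp only [Set.Icc.coe_one] at this
    rw [h1.2 s, hrow, sub_dotProduct, this, hyk]
    generalize gradient M.loss (output μ Wout H k) = v
    simp [dotProduct, PiLp.inner_apply]

end Representation

/-! ### The matrices as functions of the second moments and of the outputs -/

section Matrices

variable {K din dout : ℕ}

/-- Extension by zero of a path of tables indexed by `0, …, k`. -/
def extendGram (k : Fin K) (G : I → Matrix (Fin (k + 1)) (Fin (k + 1)) ℝ) : I → Gram K :=
  fun s i j => if h : i ≤ k ∧ j ≤ k then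
    G s ⟨i, Nat.lt_succ_of_le h.1⟩ ⟨j, Nat.lt_succ_of_le h.2⟩ else 0

/-- Extension by zero of a family of outputs indexed by `0, …, n - 1`. -/
def extendOutput {n : ℕ} (y : Fin n → Euc dout) : Fin K → Euc dout :=
  fun j => if h : (j : ℕ) < n then y ⟨j, h⟩ else 0

variable (M : Model din dout)

/-- The matrix `Φ_k` with `H_{∧k} = Φ_k (Win, Wout)`. -/
def matrixPhi (k : Fin K) (GH GB : I → Matrix (Fin (k + 1)) (Fin (k + 1)) ℝ)
    (y : Fin k → Euc dout) (s : I) : Matrix (Fin (k + 1)) (Fin din ⊕ Fin dout) ℝ :=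
  Matrix.of fun i => rowH M (extendGram k GH) (extendGram k GB) (extendOutput y)
    (Fin.castLE k.isLt i) s

/-- The matrix `Ψ_k` with `B_{∧k} = Ψ_k (Win, Wout)`. -/
def matrixPsi (k : Fin K) (GH GB : I → Matrix (Fin (k + 1)) (Fin (k + 1)) ℝ)
    (y : Fin (k + 1) → Euc dout) (s : I) : Matrix (Fin (k + 1)) (Fin din ⊕ Fin dout) ℝ :=
  Matrix.of fun i => rowB M (extendGram k GH) (extendGram k GB) (extendOutput y)
    (Fin.castLE k.isLt i) s

variable {M} {Ω : Type*} [MeasurableSpace Ω] {μ : Measure Ω}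
  {Win : Ω → Euc din} {Wout : Ω → Euc dout} {H B Zh Zb : Ω → C(I, Euc K)}

lemma truncGram_extendGram (X : Ω → C(I, Euc K)) {i k : Fin K} (hi : i ≤ k) (s : I) :
    truncGram i (extendGram k (gammaUpTo μ X k) s) = truncGram i (gram μ X s) := by
  funext a b
  by_cases hab : a ≤ i ∧ b ≤ i
  · have h' : a ≤ k ∧ b ≤ k := ⟨hab.1.trans hi, hab.2.trans hi⟩
    simp only [truncGram, hab, h', extendGram, and_self, if_true, dite_true]
    rfl
  · simp [truncGram, hab]

lemma extendOutput_apply {n : ℕ} (hn : n ≤ K) (y : Fin K → Euc dout) {j : Fin K}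
    (hj : (j : ℕ) < n) : extendOutput (fun i => y (Fin.castLE hn i)) j = y j := by
  simp [extendOutput, hj]

lemma IsSolutionWith.matrix_spec [IsProbabilityMeasure μ] (hM : M.Regular) (hWin : Measurable Win)
    (hWout : Measurable Wout) (hS : IsSolutionWith M μ Win Wout H B Zh Zb) (k : Fin K)
    {PhiK PsiK : I → Matrix (Fin (k + 1)) (Fin din ⊕ Fin dout) ℝ}
    (hPhi : PhiK = matrixPhi M k (gammaUpTo μ H k) (gammaUpTo μ B k)
      (fun j => output μ Wout H (Fin.castLE k.isLt.le j)))
    (hPsi : PsiK = matrixPsi M k (gammaUpTo μ H k) (gammaUpTo μ B k)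
      (fun j => output μ Wout H (Fin.castLE k.isLt j))) :
    Continuous PhiK ∧ Continuous PsiK ∧ ∀ᵐ ω ∂μ, ∀ s : I,
      upTo k (H ω s) = (PhiK s).mulVec (Sum.elim (Win ω) (Wout ω)) ∧
      upTo k (B ω s) = (PsiK s).mulVec (Sum.elim (Win ω) (Wout ω)) := by
  subst hPhi hPsi
  have hle : ∀ i : Fin (k + 1), Fin.castLE k.isLt i ≤ k := fun i => Nat.le_of_lt_succ i.isLt
  have hH : ∀ i : Fin (k + 1), _ := fun i =>
    (hS.row_spec hM hWin hWout (GH := extendGram k (gammaUpTo μ H k))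
      (GB := extendGram k (gammaUpTo μ B k))
      (y := extendOutput fun j => output μ Wout H (Fin.castLE k.isLt.le j)) (Fin.castLE k.isLt i)
      (fun s => truncGram_extendGram H (hle i) s) (fun s => truncGram_extendGram B (hle i) s)
      fun j hj => extendOutput_apply k.isLt.le (output μ Wout H)
        (lt_of_lt_of_le hj (hle i))).1
  have hB : ∀ i : Fin (k + 1), _ := fun i =>
    (hS.row_spec hM hWin hWout (GH := extendGram k (gammaUpTo μ H k))
      (GB := extendGram k (gammaUpTo μ B k))
      (y := extendOutput fun j => output μ Wout H (Fin.castLE k.isLt j)) (Fin.castLE k.isLt i)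
      (fun s => truncGram_extendGram H (hle i) s) (fun s => truncGram_extendGram B (hle i) s)
      fun j hj => extendOutput_apply k.isLt (output μ Wout H)
        (Nat.lt_succ_of_lt (lt_of_lt_of_le hj (hle i)))).2
      (extendOutput_apply k.isLt (output μ Wout H) i.isLt)
  refine ⟨continuous_pi fun i => (hH i).1.comp continuous_subtype_val,
    continuous_pi fun i => (hB i).1.comp continuous_subtype_val, ?_⟩
  filter_upwards [ae_all_iff.2 fun i => (hH i).2, ae_all_iff.2 fun i => (hB i).2] with ω h1 h2 s
  exact ⟨funext fun i => h1 i s, funext fun i => h2 i s⟩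

end Matrices

/-! ### Paths that are linear in the embeddings -/

section Linear

variable {K din dout : ℕ}

lemma continuous_matOpNorm {m n : Type*} [Fintype m] [Fintype n] [DecidableEq n] :
    Continuous (matOpNorm : Matrix m n ℝ → ℝ) := by
  let L : Matrix m n ℝ →ₗ[ℝ] (EuclideanSpace ℝ n →L[ℝ] EuclideanSpace ℝ m) :=
    LinearMap.toContinuousLinearMap.toLinearMap ∘ₗ Matrix.toEuclideanLin.toLinearMap
  exact continuous_norm.comp L.continuous_of_finiteDimensional

lemma matOpNorm_nonneg {m n : Type*} [Fintype m] [Fintype n] [DecidableEq n] (A : Matrix m n ℝ) :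
    0 ≤ matOpNorm A := norm_nonneg _

lemma norm_toLp_sumElim_le (a : Euc din) (b : Euc dout) :
    ‖(WithLp.toLp 2 (Sum.elim a b) : EuclideanSpace ℝ (Fin din ⊕ Fin dout))‖ ≤ ‖a‖ + ‖b‖ := by
  refine abs_le_of_sq_le_sq' ?_ (by positivity) |>.2
  have : ‖(WithLp.toLp 2 (Sum.elim a b) : EuclideanSpace ℝ (Fin din ⊕ Fin dout))‖ ^ 2 =
      ‖a‖ ^ 2 + ‖b‖ ^ 2 := by
    simp [EuclideanSpace.norm_sq_eq]
  rw [this]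
  nlinarith [norm_nonneg a, norm_nonneg b]

/-- For the last index, `upTo` loses no coordinate. -/
lemma norm_toLp_upTo_last (hK : 1 ≤ K) (v : Euc K) :
    ‖(WithLp.toLp 2 (upTo ⟨K - 1, Nat.sub_one_lt_of_lt hK⟩ v) : EuclideanSpace ℝ _)‖ = ‖v‖ := by
  rw [EuclideanSpace.norm_eq, EuclideanSpace.norm_eq]
  congr 1
  refine Fintype.sum_equiv (finCongr (Nat.sub_add_cancel hK)) _ _ fun i => ?_
  rfl

lemma norm_le_of_upTo_last_eq (hK : 1 ≤ K) {v : Euc K} {a : Euc din} {b : Euc dout}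
    {A : Matrix (Fin (K - 1 + 1)) (Fin din ⊕ Fin dout) ℝ}
    (h : upTo ⟨K - 1, Nat.sub_one_lt_of_lt hK⟩ v = A.mulVec (Sum.elim a b)) :
    ‖v‖ ≤ matOpNorm A * (‖a‖ + ‖b‖) := by
  rw [← norm_toLp_upTo_last hK v, h]
  calc _ ≤ matOpNorm A *
        ‖(WithLp.toLp 2 (Sum.elim a b) : EuclideanSpace ℝ (Fin din ⊕ Fin dout))‖ :=
        (LinearMap.toContinuousLinearMap (Matrix.toEuclideanLin A)).le_opNorm
          (WithLp.toLp 2 (Sum.elim a b))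
    _ ≤ _ := mul_le_mul_of_nonneg_left (norm_toLp_sumElim_le a b) (matOpNorm_nonneg A)

/-- The linear map `(a, b) ↦ A (a, b)` with values in `ℝᴷ`. -/
def blockMap (hK : 1 ≤ K) (A : Matrix (Fin (K - 1 + 1)) (Fin din ⊕ Fin dout) ℝ) :
    (Euc din × Euc dout) →L[ℝ] Euc K :=
  LinearMap.toContinuousLinearMap
    { toFun := fun z => WithLp.toLp 2 fun i =>
        A.mulVec (Sum.elim z.1 z.2) (Fin.cast (Nat.sub_add_cancel hK).symm i)
      map_add' := fun z w => by
        ext i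
        have : Sum.elim (z + w).1.ofLp (z + w).2.ofLp =
            Sum.elim z.1.ofLp z.2.ofLp + Sum.elim w.1.ofLp w.2.ofLp := by
          ext (l | l) <;> rfl
        change A.mulVec _ _ = _
        rw [this, Matrix.mulVec_add]
        rfl
      map_smul' := fun c z => by
        ext i
        have : Sum.elim (c • z).1.ofLp (c • z).2.ofLp = c • Sum.elim z.1.ofLp z.2.ofLp := by
          ext (l | l) <;> rfl
        change A.mulVec _ _ = _
        rw [this, Matrix.mulVec_smul]
        rfl }

lemma eq_blockMap (hK : 1 ≤ K) {v : Euc K} {a : Euc din} {b : Euc dout}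
    {A : Matrix (Fin (K - 1 + 1)) (Fin din ⊕ Fin dout) ℝ}
    (h : upTo ⟨K - 1, Nat.sub_one_lt_of_lt hK⟩ v = A.mulVec (Sum.elim a b)) :
    v = blockMap hK A (a, b) := by
  ext i
  exact congrFun h (Fin.cast (Nat.sub_add_cancel hK).symm i)

variable {Ω : Type*} [MeasurableSpace Ω] {μ : Measure Ω}

lemma IsSubgaussianVector.memLp [IsProbabilityMeasure μ] {n : ℕ} {X : Ω → Euc n}
    (hX : IsSubgaussianVector X μ) {p : ℝ≥0∞} (hp : p ≠ ∞) : MemLp X p μ := by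
  obtain ⟨-, c, hc⟩ := hX
  lift p to ℝ≥0 using hp
  refine MemLp.of_eval_piLp fun i => ?_
  have h := ((hc (EuclideanSpace.single i 1)).memLp p).add (memLp_const ((∫ ω, X ω ∂μ) i))
  refine h.ae_eq (.of_forall fun ω => ?_)
  simp [EuclideanSpace.inner_single_left]

lemma norm_path_le (hK : 1 ≤ K) {X : C(I, Euc K)} {a : Euc din} {b : Euc dout}
    {A : I → Matrix (Fin (K - 1 + 1)) (Fin din ⊕ Fin dout) ℝ} {C : ℝ} (hC : ∀ s, matOpNorm (A s) ≤ C)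
    (h : ∀ s, upTo ⟨K - 1, Nat.sub_one_lt_of_lt hK⟩ (X s) = (A s).mulVec (Sum.elim a b)) :
    ‖X‖ ≤ C * (‖a‖ + ‖b‖) := by
  have hC0 : 0 ≤ C := (matOpNorm_nonneg _).trans (hC 0)
  exact (ContinuousMap.norm_le _ (by positivity)).2 fun s =>
    (norm_le_of_upTo_last_eq hK (h s)).trans (mul_le_mul_of_nonneg_right (hC s) (by positivity))

end Linear

end LimitDynamics

end

theorem mainTheorem7 {K din dout : ℕ} (hK : 1 ≤ K) (M : LimitDynamics.Model din dout)
    (hM : M.Regular) :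
    ∃ (Phi : (k : Fin K) → (I → Matrix (Fin (k + 1)) (Fin (k + 1)) ℝ) →
          (I → Matrix (Fin (k + 1)) (Fin (k + 1)) ℝ) → (Fin k → LimitDynamics.Euc dout) →
          I → Matrix (Fin (k + 1)) (Fin din ⊕ Fin dout) ℝ)
      (Psi : (k : Fin K) → (I → Matrix (Fin (k + 1)) (Fin (k + 1)) ℝ) →
          (I → Matrix (Fin (k + 1)) (Fin (k + 1)) ℝ) → (Fin (k + 1) → LimitDynamics.Euc dout) →
          I → Matrix (Fin (k + 1)) (Fin din ⊕ Fin dout) ℝ),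
    ∀ (Ω : Type*) [MeasurableSpace Ω] (μ : Measure Ω) [IsProbabilityMeasure μ]
      (Win : Ω → LimitDynamics.Euc din) (Wout : Ω → LimitDynamics.Euc dout)
      (H B : Ω → C(I, LimitDynamics.Euc K)),
      Measurable Win → Measurable Wout →
      LimitDynamics.IsSubgaussianVector Win μ → LimitDynamics.IsSubgaussianVector Wout μ →
      LimitDynamics.IsLimitSolution M μ Win Wout H B →
      ∃ PhiK PsiK : (k : Fin K) → I → Matrix (Fin (k + 1)) (Fin din ⊕ Fin dout) ℝ,
        (∀ k : Fin K, PhiK k =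
          Phi k (LimitDynamics.gammaUpTo μ H k) (LimitDynamics.gammaUpTo μ B k)
            (fun j => LimitDynamics.output μ Wout H (Fin.castLE k.isLt.le j))) ∧
        (∀ k : Fin K, PsiK k =
          Psi k (LimitDynamics.gammaUpTo μ H k) (LimitDynamics.gammaUpTo μ B k)
            (fun j => LimitDynamics.output μ Wout H (Fin.castLE k.isLt j))) ∧
        (∀ k : Fin K, Continuous (PhiK k) ∧ Continuous (PsiK k) ∧
          ∀ᵐ ω ∂μ, ∀ s : I,
            LimitDynamics.upTo k (H ω s) = (PhiK k s).mulVec (Sum.elim (Win ω) (Wout ω)) ∧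
            LimitDynamics.upTo k (B ω s) = (PsiK k s).mulVec (Sum.elim (Win ω) (Wout ω))) ∧
        (∫ ω, Win ω ∂μ = 0 → ∫ ω, Wout ω ∂μ = 0 →
          ∀ s : I, ∫ ω, H ω s ∂μ = 0 ∧ ∫ ω, B ω s ∂μ = 0) ∧
        (HasGaussianLaw (fun ω => (Win ω, Wout ω)) μ →
          IsGaussianProcess (fun (s : I) ω => (H ω s, B ω s)) μ) ∧
        (∀ᵐ ω ∂μ, (⨆ s : I, √(‖H ω s‖ ^ 2 + ‖B ω s‖ ^ 2)) ≤
          (⨆ s : I, (LimitDynamics.matOpNorm (PhiK ⟨K - 1, Nat.sub_one_lt_of_lt hK⟩ s) +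
            LimitDynamics.matOpNorm (PsiK ⟨K - 1, Nat.sub_one_lt_of_lt hK⟩ s))) *
            (‖Win ω‖ + ‖Wout ω‖)) ∧
        ((∃ C : ℝ, ∀ᵐ ω ∂μ, ‖Win ω‖ ≤ C ∧ ‖Wout ω‖ ≤ C) →
          ∃ C : ℝ, ∀ᵐ ω ∂μ, ‖H ω‖ ≤ C ∧ ‖B ω‖ ≤ C) ∧
        (∀ p : ℝ≥0∞, p ≠ ∞ → MemLp H p μ ∧ MemLp B p μ) := by
  refine ⟨LimitDynamics.matrixPhi M, LimitDynamics.matrixPsi M, ?_⟩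
  intro Ω _ μ _ Win Wout H B hWin hWout hsin hsout ⟨Zh, Zb, hS⟩
  let PhiK : (k : Fin K) → I → Matrix (Fin (k + 1)) (Fin din ⊕ Fin dout) ℝ := fun k =>
    LimitDynamics.matrixPhi M k (LimitDynamics.gammaUpTo μ H k) (LimitDynamics.gammaUpTo μ B k)
      (fun j => LimitDynamics.output μ Wout H (Fin.castLE k.isLt.le j))
  let PsiK : (k : Fin K) → I → Matrix (Fin (k + 1)) (Fin din ⊕ Fin dout) ℝ := fun k =>
    LimitDynamics.matrixPsi M k (LimitDynamics.gammaUpTo μ H k) (LimitDynamics.gammaUpTo μ B k)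
      (fun j => LimitDynamics.output μ Wout H (Fin.castLE k.isLt j))
  have hspec : ∀ k : Fin K, Continuous (PhiK k) ∧ Continuous (PsiK k) ∧ ∀ᵐ ω ∂μ, ∀ s : I,
      LimitDynamics.upTo k (H ω s) = (PhiK k s).mulVec (Sum.elim (Win ω) (Wout ω)) ∧
      LimitDynamics.upTo k (B ω s) = (PsiK k s).mulVec (Sum.elim (Win ω) (Wout ω)) :=
    fun k => hS.matrix_spec hM hWin hWout k rfl rfl
  refine ⟨PhiK, PsiK, fun _ => rfl, fun _ => rfl, hspec, ?_⟩
  obtain ⟨hPhi, hPsi, hrep⟩ := hspec ⟨K - 1, Nat.sub_one_lt_of_lt hK⟩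
  set A := PhiK ⟨K - 1, Nat.sub_one_lt_of_lt hK⟩ with hA
  set A' := PsiK ⟨K - 1, Nat.sub_one_lt_of_lt hK⟩ with hA'
  clear_value A A'
  have hcA := LimitDynamics.continuous_matOpNorm.comp hPhi
  have hcA' := LimitDynamics.continuous_matOpNorm.comp hPsi
  obtain ⟨C, hC⟩ := (isCompact_range hcA).bddAbove
  obtain ⟨C', hC'⟩ := (isCompact_range hcA').bddAbove
  have hle : ∀ᵐ ω ∂μ, ‖H ω‖ ≤ C * (‖Win ω‖ + ‖Wout ω‖) ∧ ‖B ω‖ ≤ C' * (‖Win ω‖ + ‖Wout ω‖) := by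
    filter_upwards [hrep] with ω hω
    exact ⟨LimitDynamics.norm_path_le hK (fun s => hC ⟨s, rfl⟩) fun s => (hω s).1,
      LimitDynamics.norm_path_le hK (fun s => hC' ⟨s, rfl⟩) fun s => (hω s).2⟩
  have hmap : ∀ s : I, (fun ω => (H ω s, B ω s)) =ᵐ[μ] fun ω =>
      (LimitDynamics.blockMap hK (A s) (Win ω, Wout ω),
        LimitDynamics.blockMap hK (A' s) (Win ω, Wout ω)) := fun s => by
    filter_upwards [hrep] with ω hω
    rw [← LimitDynamics.eq_blockMap hK (hω s).1, ← LimitDynamics.eq_blockMap hK (hω s).2]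
  refine ⟨fun h0 h0' s => ?_, fun hG => ?_, ?_, ?_, fun p hp => ?_⟩
  · have hint : Integrable (fun ω => (Win ω, Wout ω)) μ := hsin.1.prodMk hsout.1
    have hzero : ∫ ω, (Win ω, Wout ω) ∂μ = 0 := by
      rw [integral_pair hsin.1 hsout.1, h0, h0']
      rfl
    have e1 : (fun ω => H ω s) =ᵐ[μ] fun ω => LimitDynamics.blockMap hK (A s) (Win ω, Wout ω) :=
      (hmap s).mono fun ω h => congrArg Prod.fst h
    have e2 : (fun ω => B ω s) =ᵐ[μ] fun ω => LimitDynamics.blockMap hK (A' s) (Win ω, Wout ω) :=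
      (hmap s).mono fun ω h => congrArg Prod.snd h
    rw [integral_congr_ae e1, integral_congr_ae e2, ContinuousLinearMap.integral_comp_comm _ hint,
      ContinuousLinearMap.integral_comp_comm _ hint, hzero, map_zero, map_zero]
    exact ⟨rfl, rfl⟩
  · refine IsGaussianProcess.congr (X := fun (s : I) ω =>
      (LimitDynamics.blockMap hK (A s) (Win ω, Wout ω),
        LimitDynamics.blockMap hK (A' s) (Win ω, Wout ω))) ⟨fun J => ?_⟩ fun s => (hmap s).symm
    exact hG.map_fun (ContinuousLinearMap.pi fun s : J =>
      (LimitDynamics.blockMap hK (A s)).prod (LimitDynamics.blockMap hK (A' s)))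
  · have hbdd : BddAbove (Set.range fun s : I =>
        LimitDynamics.matOpNorm (A s) + LimitDynamics.matOpNorm (A' s)) :=
      (isCompact_range (hcA.add hcA')).bddAbove
    filter_upwards [hrep] with ω hω
    refine ciSup_le fun s => ?_
    have h1 := LimitDynamics.norm_le_of_upTo_last_eq hK (hω s).1
    have h2 := LimitDynamics.norm_le_of_upTo_last_eq hK (hω s).2
    have h3 : √(‖H ω s‖ ^ 2 + ‖B ω s‖ ^ 2) ≤ ‖H ω s‖ + ‖B ω s‖ :=
      Real.sqrt_le_iff.2 ⟨by positivity, by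
        nlinarith [norm_nonneg (H ω s), norm_nonneg (B ω s)]⟩
    calc √(‖H ω s‖ ^ 2 + ‖B ω s‖ ^ 2)
        ≤ (LimitDynamics.matOpNorm (A s) + LimitDynamics.matOpNorm (A' s)) *
            (‖Win ω‖ + ‖Wout ω‖) := by linarith
      _ ≤ _ := mul_le_mul_of_nonneg_right (le_ciSup hbdd s) (by positivity)
  · rintro ⟨R, hR⟩
    refine ⟨max (C * (R + R)) (C' * (R + R)), ?_⟩
    have hC0 : 0 ≤ C := (LimitDynamics.matOpNorm_nonneg _).trans (hC ⟨0, rfl⟩)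
    have hC0' : 0 ≤ C' := (LimitDynamics.matOpNorm_nonneg _).trans (hC' ⟨0, rfl⟩)
    filter_upwards [hle, hR] with ω h1 h2
    have h3 : ‖Win ω‖ + ‖Wout ω‖ ≤ R + R := add_le_add h2.1 h2.2
    exact ⟨le_max_of_le_left (h1.1.trans (mul_le_mul_of_nonneg_left h3 hC0)),
      le_max_of_le_right (h1.2.trans (mul_le_mul_of_nonneg_left h3 hC0'))⟩
  · have hW : MemLp (fun ω => ‖Win ω‖ + ‖Wout ω‖) p μ :=
      (hsin.memLp hp).norm.add (hsout.memLp hp).norm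
    refine ⟨(hW.const_mul C).of_le hS.memLp_H.1 ?_, (hW.const_mul C').of_le hS.memLp_B.1 ?_⟩
    · filter_upwards [hle] with ω h
      exact h.1.trans (le_abs_self _)
    · filter_upwards [hle] with ω h
      exact h.2.trans (le_abs_self _)
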